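/- Let $n\ge 1$ and let $q\in\mathbb C\setminus\{0\}$ not be a root of unity. Let $\mathcal A_q^+$ be the unital complex algebra with generators $Z_{ij}$ ($1\le i,j\le n$) and relations $Z_{ij}Z_{ik}=q^{-1}Z_{ik}Z_{ij}$ if $j<k$; $Z_{ij}Z_{kj}=q^{-1}Z_{kj}Z_{ij}$ if $i<k$; $Z_{ij}Z_{st}=Z_{st}Z_{ij}$ if $i<s$ and $t<j$; $Z_{ij}Z_{st}=Z_{st}Z_{ij}-(q-q^{-1})Z_{it}Z_{sj}$ if $i<s$ and $j<t$. Let $\mathcal A_q^-$ be the algebra with generators $W_{ij}$ and identical relations. For $\mathbf a\in\mathbb N_0^{n\times n}$ put $Z^{\mathbf a}=Z_{11}^{a_{11}}Z_{21}^{a_{21}}\cdots Z_{n1}^{a_{n1}}Z_{12}^{a_{12}}\cdots Z_{nn}^{a_{nn}}$, and define $W^{\mathbf a}$ in the same way. Then the $Z^{\mathbf a}$ form a basis of $\mathcal A_q^+$ and the $W^{\mathbf a}$ a basis of $\mathcal A_q^-$. Put $[a]=q^{-a+1}+q^{-a+3}+\cdots+q^{a-1}$ and $\{\{a\}\}=1+q^{-2}+\cdots+q^{-(2a-2)}$.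 Let $e_{ij}$ denote the matrix unit at $(i,j)$, and define linear operators on $\mathcal A_q^+$ by $M_{ij}Z^{\mathbf a}=Z^{\mathbf a+e_{ij}}$, $D_{ij}Z^{\mathbf a}=[a_{ij}]Z^{\mathbf a-e_{ij}}$, $\mathcal D_{ij}Z^{\mathbf a}=\{\{a_{ij}\}\}Z^{\mathbf a-e_{ij}}$, $H_{ij}Z^{\mathbf a}=q^{a_{ij}}Z^{\mathbf a}$ and $V^{SE}_{ij}=\prod_{k>i}H_{kj}\prod_{s>j}H_{is}$. Let $\mathcal Weyl_q(n,n)$ be the unital algebra of operators on $\mathcal A_q^+$ generated by all $M_{ij}$ and $D_{ij}$. Let $(\cdot,\cdot)_L$ and $(\cdot,\cdot)_K$ be the bilinear forms on $\mathcal A_q^+\times\mathcal A_q^-$ with $$(Z^{\mathbf a},W^{\mathbf b})_L=\delta_{\mathbf a,\mathbf b}\Big(\frac{-1}{q-q^{-1}}\Big)^{|\mathbf a|}\prod_{i,j}[a_{ij}]!,\qquad (Z^{\mathbf a},W^{\mathbf b})_K=\delta_{\mathbf a,\mathbf b}\Big(\frac{-1}{q-q^{-1}}\Big)^{|\mathbf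 a|}\prod_{i,j}\{\{a_{ij}\}\}!,$$ where $|\mathbf a|=\sum_{i,j}a_{ij}$, $[a]!=\prod_{k=1}^a[k]$ and $\{\{a\}\}!=\prod_{k=1}^a\{\{k\}\}$. For $X\in\{L,K\}$ and every $(i,j)$ there is a unique linear operator $(\partial/\partial Z_{ij})_X$ on $\mathcal A_q^+$ with $((\partial/\partial Z_{ij})_X\,u,w)_X=(u,wW_{ij})_X$ for all $u\in\mathcal A_q^+$, $w\in\mathcal A_q^-$. Let $\mathcal D(\partial_X,M_Z)$ be the unital algebra of operators on $\mathcal A_q^+$ generated by all $(\partial/\partial Z_{ij})_X$ and all right multiplications $M_{Z_{ij}}:u\mapsto uZ_{ij}$. Then: 1. $\mathcal D(\partial_L,M_Z)=\mathcal Weyl_q(n,n)$. 2. $\mathcal D(\partial_K,M_Z)$ is the unital algebra generated by all the operators $V^{SE}_{ij}\mathcal D_{ij}$ and $V^{SE}_{ij}M_{ij}$, $1\le i,j\le n$. 3. $(H_{ij})^{2}$ and $(H_{ij})^{-2}$ belong to $\mathcal D(\partial_K,M_Z)$ for every $(i,j)\ne(1,1)$, whereas $(H_{11})^{-2}\in\mathcal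 D(\partial_K,M_Z)$ and $(H_{11})^{2}\notin\mathcal D(\partial_K,M_Z)$. -/

import Mathlib

open scoped BigOperators

noncomputable section

namespace QuantumMatrix

/-- The defining quadratic relations of the quantized `n × n` matrix algebra. -/
inductive Rel (n : ℕ) (q : ℂ) :
    FreeAlgebra ℂ (Fin n × Fin n) → FreeAlgebra ℂ (Fin n × Fin n) → Prop
  | row (i j k : Fin n) (h : j < k) :
      Rel n q (FreeAlgebra.ι ℂ (i, j) * FreeAlgebra.ι ℂ (i, k))
        (q⁻¹ • (FreeAlgebra.ι ℂ (i, k) * FreeAlgebra.ι ℂ (i, j)))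
  | col (i k j : Fin n) (h : i < k) :
      Rel n q (FreeAlgebra.ι ℂ (i, j) * FreeAlgebra.ι ℂ (k, j))
        (q⁻¹ • (FreeAlgebra.ι ℂ (k, j) * FreeAlgebra.ι ℂ (i, j)))
  | comm (i j s t : Fin n) (h : i < s) (h' : t < j) :
      Rel n q (FreeAlgebra.ι ℂ (i, j) * FreeAlgebra.ι ℂ (s, t))
        (FreeAlgebra.ι ℂ (s, t) * FreeAlgebra.ι ℂ (i, j))
  | cross (i j s t : Fin n) (h : i < s) (h' : j < t) :
      Rel n q (FreeAlgebra.ι ℂ (i, j) * FreeAlgebra.ι ℂ (s, t))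
        (FreeAlgebra.ι ℂ (s, t) * FreeAlgebra.ι ℂ (i, j) -
          (q - q⁻¹) • (FreeAlgebra.ι ℂ (i, t) * FreeAlgebra.ι ℂ (s, j)))

/-- The quadratic algebra generated by `n²` elements subject to `Rel`. The algebras `A_q^+`
(generators `Z_ij`) and `A_q^-` (generators `W_ij`) have identical presentations, so each of
them is a copy of this algebra. -/
abbrev Alg (n : ℕ) (q : ℂ) : Type := RingQuot (Rel n q)

variable {n : ℕ} {q : ℂ}

/-- The generator at the node `(i, j)`: `Z_ij` in `A_q^+`, respectively `W_ij` in `A_q^-`. -/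
def gen (q : ℂ) (i j : Fin n) : Alg n q :=
  RingQuot.mkAlgHom ℂ (Rel n q) (FreeAlgebra.ι ℂ (i, j))

/-- Exponents of the ordered monomials. -/
abbrev Expo (n : ℕ) : Type := Fin n → Fin n → ℕ

/-- The ordered monomial
`Z_11^{a_11} Z_21^{a_21} ⋯ Z_n1^{a_n1} Z_12^{a_12} ⋯ Z_nn^{a_nn}`. -/
def mono (q : ℂ) (a : Expo n) : Alg n q :=
  ((List.finRange n).map fun j =>
    ((List.finRange n).map fun i => gen q i j ^ a i j).prod).prod

/-- The exponent which is `1` at the node `(i, j)` and `0` elsewhere. -/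
def unitExpo (i j : Fin n) : Expo n := Pi.single i (Pi.single j 1)

/-! Quantized integers. -/

/-- `[a]_q = q^{-a+1} + q^{-a+3} + ⋯ + q^{a-1}` (case `L`). -/
def qnumL (q : ℂ) (a : ℕ) : ℂ := ∑ k ∈ Finset.range a, q ^ (2 * (k : ℤ) - a + 1)

/-- `{{a}}_q = 1 + q^{-2} + ⋯ + q^{-(2a-2)}` (case `K`). -/
def qnumK (q : ℂ) (a : ℕ) : ℂ := ∑ k ∈ Finset.range a, q ^ (-(2 * (k : ℤ)))

/-- The factorial attached to a family of quantized integers. -/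
def qfact (ν : ℕ → ℂ) (a : ℕ) : ℂ := ∏ k ∈ Finset.range a, ν (k + 1)

/-! Operators given by their values on a basis `b` indexed by exponents; `b` will be the basis of
ordered monomials, `b a = Z^a`. -/

/-- `M^o_ij : Z^a ↦ Z^{a + e_ij}`. -/
def opM (b : Module.Basis (Expo n) ℂ (Alg n q)) (i j : Fin n) : Module.End ℂ (Alg n q) :=
  b.constr ℂ fun a => b (a + unitExpo i j)

/-- `Z^a ↦ ν(a_ij) Z^{a - e_ij}`, where `ν 0 = 0`. -/
def opLower (b : Module.Basis (Expo n) ℂ (Alg n q)) (ν : ℕ → ℂ) (i j : Fin n) :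
    Module.End ℂ (Alg n q) :=
  b.constr ℂ fun a => ν (a i j) • b (a - unitExpo i j)

/-- `D^o_ij : Z^a ↦ [a_ij]_q Z^{a - e_ij}`. -/
def opD (b : Module.Basis (Expo n) ℂ (Alg n q)) (i j : Fin n) : Module.End ℂ (Alg n q) :=
  opLower b (qnumL q) i j

/-- `𝒟^o_ij : Z^a ↦ {{a_ij}}_q Z^{a - e_ij}`. -/
def opCalD (b : Module.Basis (Expo n) ℂ (Alg n q)) (i j : Fin n) : Module.End ℂ (Alg n q) :=
  opLower b (qnumK q) i j

/-- `(H^o_ij)^m : Z^a ↦ q^{m a_ij} Z^a`, for an integer `m`. -/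
def opH (b : Module.Basis (Expo n) ℂ (Alg n q)) (m : ℤ) (i j : Fin n) :
    Module.End ℂ (Alg n q) :=
  b.constr ℂ fun a => q ^ (m * (a i j : ℤ)) • b a

theorem opH_zero (b : Module.Basis (Expo n) ℂ (Alg n q)) (i j : Fin n) : opH b 0 i j = 1 := by
  refine b.ext fun a => ?_
  simp [opH]

theorem opH_add (hq : q ≠ 0) (b : Module.Basis (Expo n) ℂ (Alg n q)) (m k : ℤ) (i j : Fin n) :
    opH b (m + k) i j = opH b m i j * opH b k i j := by
  refine b.ext fun a => ?_
  simp only [opH, Module.End.mul_apply, Module.Basis.constr_basis, map_smul, smul_smul]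
  rw [add_mul, zpow_add₀ hq, mul_comm]

/-- `V^{SE}_ij = (∏_{k > i} H^o_kj) (∏_{s > j} H^o_is)`. -/
def opVSE (b : Module.Basis (Expo n) ℂ (Alg n q)) (i j : Fin n) : Module.End ℂ (Alg n q) :=
  (((List.finRange n).filter fun k => i < k).map fun k => opH b 1 k j).prod *
    (((List.finRange n).filter fun s => j < s).map fun s => opH b 1 i s).prod

/-- The quantized Weyl algebra: the algebra of operators on `A_q^+` generated by all `M^o_ij`
and `D^o_ij`. -/
def weyl (b : Module.Basis (Expo n) ℂ (Alg n q)) : Subalgebra ℂ (Module.End ℂ (Alg n q)) :=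
  Algebra.adjoin ℂ
    ({T | ∃ i j : Fin n, T = opM b i j} ∪ {T | ∃ i j : Fin n, T = opD b i j})

/-- The bilinear form on `A_q^+ × A_q^-` with
`(Z^a, W^c) = δ_{a,c} (-1 / (q - q⁻¹))^{|a|} ∏_{ij} ν(a_ij)!`. -/
def pairing (b : Module.Basis (Expo n) ℂ (Alg n q)) (ν : ℕ → ℂ) :
    Alg n q →ₗ[ℂ] Alg n q →ₗ[ℂ] ℂ :=
  b.constr ℂ fun a =>
    ((-1 / (q - q⁻¹)) ^ (∑ i, ∑ j, a i j) * ∏ i, ∏ j, qfact ν (a i j)) • b.coord a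

/-- Right multiplication by the generator at `(i, j)`: `M_{Z_ij}` on `A_q^+`, respectively
`M_{W_ij}` on `A_q^-`. -/
def rightMul (q : ℂ) (i j : Fin n) : Module.End ℂ (Alg n q) :=
  LinearMap.mulRight ℂ (gen q i j)

/-- `S`, an operator on `A_q^+`, is the dual of `T`, an operator on `A_q^-`, for the form `B`. -/
def IsDual (B : Alg n q →ₗ[ℂ] Alg n q →ₗ[ℂ] ℂ) (T S : Module.End ℂ (Alg n q)) : Prop :=
  ∀ u w, B (S u) w = B u (T w)

/-- `𝒟(∂_X, M_Z)`: the algebra of operators on `A_q^+` generated by the right multiplications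
`M_{Z_ij}` and by the duals `∂_X` of the right multiplications `M_{W_ij}` on `A_q^-`, where `X`
is the form given by the quantized integers `ν`. -/
def diffAlg (b : Module.Basis (Expo n) ℂ (Alg n q)) (ν : ℕ → ℂ) :
    Subalgebra ℂ (Module.End ℂ (Alg n q)) :=
  Algebra.adjoin ℂ
    ({S | ∃ i j : Fin n, IsDual (pairing b ν) (rightMul q i j) S} ∪
      {S | ∃ i j : Fin n, S = rightMul q i j})

end QuantumMatrix

end

/-!
The operators `M_p`, `D_p` and `q^{⟨x, a⟩}` (for integer weights `x`) on the span of the ordered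
monomials satisfy the relations of the `q`-Weyl algebra, `QWeyl`. Moving `Z_ij` to the left past a
monomial in a single column `t > j` produces a combination of the `Z_sj`, `s ≥ i`, whose
coefficients are elements `colTransfer t i s` of the `q`-Weyl algebra at that column. These
coefficients again satisfy the relations of a quantum matrix, and the product of two quantum
matrices with commuting entries is a quantum matrix (`IsQuantumMatrix.mul`). So the elements
`mulGen i j`, built column by column, satisfy the relations of right multiplications. Hence the
quadratic algebra acts from the right on formal ordered monomials, and `Z^a` moves `1` to the
formal monomial with exponent `a`; this proves that the ordered monomials are linearly independent.
They span because the products of the column subalgebras, in order, absorb every generator from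
the right. In the resulting basis right multiplication by `Z_ij` *is* `mulGen i j`
(`exists_basis_mono`).

The recursion over the columns, suitably normalized (`twistedMul_succ`), shows that right
multiplication by `Z_p` is `V^SE_p M_p` plus terms that are products of operators at nodes weakly
south-east of `p` and different from `p` (`mulGen_sub_lead_mem`). For a diagonal form the dual of
`V^SE M` is a multiple of `V^SE D^ν`, so an induction from the south-east corner shows that the right
multiplications and their duals generate the same algebra as all `V^SE M` and `V^SE D^ν`
(`diffAlg_eq_leadAlg`), as soon as the lower order terms can be written in these generators.

For `L` one recovers `V^SE`, then `M`, `D` and `H^{±1}`, node by node from the corner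
(`weyl_mem_of_lead_mem`). For `K`, with `A = V^SE M` and `B = V^SE 𝒟`, one has
`B A - A B = (V^SE)² H⁻²` and `B A - q⁻² A B = (V^SE)²`; the first identity gives `H⁻²` at every
node and the second one `H²` at every node that lies in the hook of another node, that is, at every
node except `(1, 1)`. Every element of the algebra has matrix coefficients that are, after
multiplication by a power of `M_11`, polynomials in `q^{-2 a_11}`; as `q^{2m}` is not a polynomial
in `q^{-2m}`, the operator `H_11²` is missing (`K_two_notMem_polynomialPart`).
-/

namespace QuantumMatrix

/-! ### Quantum matrices over an arbitrary algebra -/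

section QuantumMatrices

variable {n : ℕ} {B : Type*} [Ring B] [Algebra ℂ B]

/-- The family `X` satisfies the relations of a quantum matrix with parameter `p`. The defining
relations of `Alg n q` are those with `p = q⁻¹`; composing right multiplications reverses
products, so that these satisfy the relations with `p = q`. -/
structure IsQuantumMatrix (p : ℂ) (X : Fin n → Fin n → B) : Prop where
  row : ∀ i {j k}, j < k → X i j * X i k = p • (X i k * X i j)
  col : ∀ {i k} j, i < k → X i j * X k j = p • (X k j * X i j)
  comm : ∀ {i s t j}, i < s → t < j → X i j * X s t = X s t * X i j
  cross : ∀ {i s j t}, i < s → j < t →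
    X i j * X s t = X s t * X i j + (p - p⁻¹) • (X i t * X s j)

/-- A double sum vanishes if its diagonal terms and its symmetrized off-diagonal terms do. -/
theorem sum_sum_eq_zero_of_pairs {A : Type*} [AddCommGroup A] (f : Fin n → Fin n → A)
    (hd : ∀ k, f k k = 0) (hp : ∀ k l, k < l → f k l + f l k = 0) :
    ∑ k, ∑ l, f k l = 0 := by
  rw [← Finset.sum_product']
  refine Finset.sum_involution (fun x _ => (x.2, x.1)) ?_ ?_ (by simp) (by simp)
  · rintro ⟨k, l⟩ -
    rcases lt_trichotomy k l with h | rfl | h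
    · exact hp k l h
    · simp [hd]
    · rw [add_comm]; exact hp l k h
  · rintro ⟨k, l⟩ - h0 h
    obtain rfl : l = k := congrArg Prod.fst h
    exact h0 (hd _)

theorem mul_mul_mul_of_swap {α : ℂ} {a u v b : B} (h : u * v = α • (v * u)) :
    a * u * (v * b) = α • (a * v * (u * b)) := by
  rw [mul_assoc, ← mul_assoc u, h]
  simp [mul_assoc]

theorem sum_mul_sum_of_commute {R : Type*} [Ring R] {T X : Fin n → Fin n → R}
    (hTX : ∀ i j k l, Commute (T i j) (X k l)) (i j s t : Fin n) :
    (∑ k, T i k * X k j) * (∑ l, T s l * X l t) =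
      ∑ k, ∑ l, (T i k * T s l) * (X k j * X l t) := by
  rw [Finset.sum_mul_sum]
  refine Finset.sum_congr rfl fun k _ => Finset.sum_congr rfl fun l _ => ?_
  exact (hTX s l k j).symm.mul_mul_mul_comm _ _

/-- The product of two quantum matrices whose entries commute with each other is a quantum
matrix. -/
theorem IsQuantumMatrix.mul {p : ℂ} (hp : p ≠ 0) {T X : Fin n → Fin n → B}
    (hT : IsQuantumMatrix p T) (hX : IsQuantumMatrix p X)
    (hTX : ∀ i j k l, Commute (T i j) (X k l)) :
    IsQuantumMatrix p fun i j => ∑ k, T i k * X k j := by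
  constructor
  · intro i j k hjk
    rw [← sub_eq_zero, sum_mul_sum_of_commute hTX, sum_mul_sum_of_commute hTX]
    simp only [Finset.smul_sum, ← Finset.sum_sub_distrib]
    refine sum_sum_eq_zero_of_pairs _ (fun a => ?_) fun a b hab => ?_
    · rw [hX.row a hjk]; simp
    · rw [hT.row i hab, hX.cross hab hjk, hX.comm hab hjk]
      simp only [smul_mul_assoc, mul_smul_comm, mul_add]
      match_scalars <;> field_simp <;> ring
  · intro i k j hik
    rw [← sub_eq_zero, sum_mul_sum_of_commute hTX, sum_mul_sum_of_commute hTX]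
    simp only [Finset.smul_sum, ← Finset.sum_sub_distrib]
    refine sum_sum_eq_zero_of_pairs _ (fun a => ?_) fun a b hab => ?_
    · rw [hT.col a hik]; simp
    · rw [hX.col j hab, hT.cross hik hab, hT.comm hik hab]
      simp only [smul_mul_assoc, mul_smul_comm, add_mul]
      match_scalars <;> field_simp <;> ring
  · intro i s t j his htj
    rw [← sub_eq_zero, sum_mul_sum_of_commute hTX, sum_mul_sum_of_commute hTX,
      Finset.sum_comm (f := fun k l => T s k * T i l * (X k t * X l j))]
    simp only [← Finset.sum_sub_distrib]
    refine sum_sum_eq_zero_of_pairs _ (fun a => ?_) fun a b hab => ?_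
    · rw [hT.col a his, hX.row a htj]; simp
    · rw [hT.cross his hab, hT.comm his hab, hX.cross hab htj, hX.comm hab htj]
      simp only [smul_mul_assoc, mul_smul_comm, add_mul, mul_add]
      module
  · intro i s j t his hjt
    rw [← sub_eq_zero, sub_add_eq_sub_sub, sum_mul_sum_of_commute hTX,
      sum_mul_sum_of_commute hTX, sum_mul_sum_of_commute hTX,
      Finset.sum_comm (f := fun k l => T s k * T i l * (X k t * X l j))]
    simp only [Finset.smul_sum, ← Finset.sum_sub_distrib]
    refine sum_sum_eq_zero_of_pairs _ (fun a => ?_) fun a b hab => ?_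
    · rw [hT.col a his, hX.row a hjt]
      simp only [smul_mul_assoc, mul_smul_comm]
      match_scalars
      field_simp
      ring
    · rw [hT.cross his hab, hT.comm his hab, hX.cross hab hjt, hX.comm hab hjt]
      simp only [smul_mul_assoc, mul_smul_comm, add_mul, mul_add]
      module

end QuantumMatrices

/-! ### The abstract `q`-Weyl relations -/

/-- Elements `M p`, `D p` (multiplication and `q`-differentiation at the node `p`) and `K x`
(the operator `Z^a ↦ q^{⟨x, a⟩} Z^a` for an integer weight `x`) of an algebra, subject to the
relations of the `q`-Weyl algebra on the set of nodes `N`. -/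
structure QWeyl (N : Type*) [DecidableEq N] (q : ℂ) (B : Type*) [Ring B] [Algebra ℂ B] where
  M : N → B
  D : N → B
  K : (N → ℤ) → B
  K_zero : K 0 = 1
  K_add : ∀ x y, K (x + y) = K x * K y
  K_M : ∀ x p, K x * M p = q ^ x p • (M p * K x)
  K_D : ∀ x p, K x * D p = q ^ (-x p) • (D p * K x)
  M_comm : ∀ p r, M p * M r = M r * M p
  D_comm : ∀ p r, D p * D r = D r * D p
  MD_comm : ∀ p r, p ≠ r → M p * D r = D r * M p
  MD : ∀ p, (q - q⁻¹) • (M p * D p) = K (Pi.single p 1) - K (-Pi.single p 1)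
  DM : ∀ p, (q - q⁻¹) • (D p * M p) = q • K (Pi.single p 1) - q⁻¹ • K (-Pi.single p 1)

namespace QWeyl

variable {N : Type*} [DecidableEq N] {q : ℂ} {B : Type*} [Ring B] [Algebra ℂ B]

/-- The image of a `q`-Weyl system under an algebra homomorphism. -/
def map {B' : Type*} [Ring B'] [Algebra ℂ B'] (f : B →ₐ[ℂ] B') (w : QWeyl N q B) :
    QWeyl N q B' where
  M p := f (w.M p)
  D p := f (w.D p)
  K x := f (w.K x)
  K_zero := by simp [w.K_zero]
  K_add x y := by simp [w.K_add]
  K_M x p := by simp [← map_mul, ← map_smul, w.K_M]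
  K_D x p := by simp only [← map_mul, ← map_smul, w.K_D]
  M_comm p r := by simp only [← map_mul, w.M_comm p]
  D_comm p r := by simp only [← map_mul, w.D_comm p]
  MD_comm p r h := by simp only [← map_mul, w.MD_comm p r h]
  MD p := by simp only [← map_mul, ← map_smul, ← map_sub, w.MD]
  DM p := by simp only [← map_mul, ← map_smul, ← map_sub, w.DM]

variable (w : QWeyl N q B)

theorem K_comm (x y : N → ℤ) : w.K x * w.K y = w.K y * w.K x := by
  rw [← w.K_add, ← w.K_add, add_comm]

theorem K_mul_K_neg (x : N → ℤ) : w.K x * w.K (-x) = 1 := by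
  rw [← w.K_add, add_neg_cancel, w.K_zero]

theorem K_neg_mul_K (x : N → ℤ) : w.K (-x) * w.K x = 1 := by
  rw [← w.K_add, neg_add_cancel, w.K_zero]

theorem MK_mul_MK (hq : q ≠ 0) (p r : N) (x y : N → ℤ) :
    w.M p * w.K x * (w.M r * w.K y) =
      q ^ (x r - y p) • (w.M r * w.K y * (w.M p * w.K x)) := by
  rw [mul_mul_mul_of_swap (w.K_M x r), mul_mul_mul_of_swap (w.K_M y p), w.M_comm, w.K_comm,
    smul_smul, ← zpow_add₀ hq]
  simp

theorem DK_mul_DK (hq : q ≠ 0) (p r : N) (x y : N → ℤ) :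
    w.D p * w.K x * (w.D r * w.K y) =
      q ^ (y p - x r) • (w.D r * w.K y * (w.D p * w.K x)) := by
  rw [mul_mul_mul_of_swap (w.K_D x r), mul_mul_mul_of_swap (w.K_D y p), w.D_comm, w.K_comm,
    smul_smul, ← zpow_add₀ hq]
  congr 2
  ring

theorem DK_mul_MK (hq : q ≠ 0) {p r : N} (h : p ≠ r) (x y : N → ℤ) :
    w.D p * w.K x * (w.M r * w.K y) =
      q ^ (x r + y p) • (w.M r * w.K y * (w.D p * w.K x)) := by
  rw [mul_mul_mul_of_swap (w.K_M x r), mul_mul_mul_of_swap (w.K_D y p), w.MD_comm _ _ h.symm,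
    w.K_comm, smul_smul, ← zpow_add₀ hq]
  simp

theorem K_mul_MK (z : N → ℤ) (p : N) (x : N → ℤ) :
    w.K z * (w.M p * w.K x) = q ^ z p • (w.M p * w.K x * w.K z) := by
  rw [← mul_assoc, w.K_M, smul_mul_assoc, mul_assoc, w.K_comm, mul_assoc]

theorem K_mul_DK (z : N → ℤ) (p : N) (x : N → ℤ) :
    w.K z * (w.D p * w.K x) = q ^ (-z p) • (w.D p * w.K x * w.K z) := by
  rw [← mul_assoc, w.K_D, smul_mul_assoc, mul_assoc, w.K_comm, mul_assoc]

theorem K_sum_mem {ι : Type*} (S : Subalgebra ℂ B) (s : Finset ι) (f : ι → N → ℤ)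
    (h : ∀ i ∈ s, w.K (f i) ∈ S) : w.K (∑ i ∈ s, f i) ∈ S := by
  classical
  induction s using Finset.induction_on with
  | empty => simp [w.K_zero]
  | insert a s ha ih =>
    rw [Finset.sum_insert ha, w.K_add]
    exact S.mul_mem (h _ (by simp)) (ih fun i hi => h i (by simp [hi]))

end QWeyl

end QuantumMatrix

namespace QuantumMatrix
namespace QWeyl

variable {n : ℕ} {q : ℂ} {B : Type*} [Ring B] [Algebra ℂ B]

/-! ### The quantum matrices attached to a column -/

/-- The weight which is `1` at the nodes of column `t` below row `i`. -/
def below (i t : Fin n) : Fin n × Fin n → ℤ := fun p => if p.2 = t ∧ i < p.1 then 1 else 0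

variable (w : QWeyl (Fin n × Fin n) q B)

/-- Right multiplication by `Z_it` on the monomials in column `t` only. -/
def colMul (t i : Fin n) : B := w.M (i, t) * w.K (below i t)

/-- The lowering operator at row `s` of column `t`, twisted so that it `q`-commutes with
the `colMul`. -/
def colLower (t s : Fin n) : B := w.D (s, t) * w.K (-below s t)

/-- The transfer matrix of column `t`: moving `Z_ij`, `j < t`, to the left past a monomial `C` in
column `t` gives `C Z_ij = ∑ s, Z_sj (colTransfer t i s) C`. -/
noncomputable def colTransfer (t i s : Fin n) : B :=
  if i < s then (q - q⁻¹) • (w.colMul t i * w.colLower t s)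
  else if i = s then w.K (Pi.single (i, t) 1) else 0

variable {w}

theorem colTransfer_lt {t i s : Fin n} (h : i < s) :
    w.colTransfer t i s = (q - q⁻¹) • (w.colMul t i * w.colLower t s) := by
  simp [colTransfer, h]

theorem colTransfer_self (t i : Fin n) : w.colTransfer t i i = w.K (Pi.single (i, t) 1) := by
  simp [colTransfer]

theorem colTransfer_gt {t i s : Fin n} (h : s < i) : w.colTransfer t i s = 0 := by
  simp [colTransfer, h.not_gt, h.ne']

theorem colMul_mul_colMul (hq : q ≠ 0) (t : Fin n) {i k : Fin n} (h : i < k) :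
    w.colMul t i * w.colMul t k = q • (w.colMul t k * w.colMul t i) := by
  simp [colMul, w.MK_mul_MK hq (i, t) (k, t), below, h, h.not_gt]

theorem colLower_mul_colLower (hq : q ≠ 0) (t : Fin n) {r s : Fin n} (h : r < s) :
    w.colLower t r * w.colLower t s = q • (w.colLower t s * w.colLower t r) := by
  simp [colLower, w.DK_mul_DK hq (r, t) (s, t), below, h, h.not_gt]

theorem colLower_mul_colMul_of_lt (hq : q ≠ 0) (t : Fin n) {i s : Fin n} (h : i < s) :
    w.colLower t s * w.colMul t i = q • (w.colMul t i * w.colLower t s) := by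
  rw [colLower, colMul, w.DK_mul_MK hq (by simp [h.ne'])]
  simp [below, h, h.not_gt]

theorem colLower_mul_colMul_of_gt (hq : q ≠ 0) (t : Fin n) {i s : Fin n} (h : s < i) :
    w.colLower t s * w.colMul t i = q⁻¹ • (w.colMul t i * w.colLower t s) := by
  rw [colLower, colMul, w.DK_mul_MK hq (by simp [h.ne])]
  simp [below, h, h.not_gt]

theorem colMul_mul_colLower_self (t i : Fin n) :
    (q - q⁻¹) • (w.colMul t i * w.colLower t i) =
      w.K (Pi.single (i, t) 1) - w.K (-Pi.single (i, t) 1) := by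
  rw [colLower, colMul, mul_mul_mul_of_swap (w.K_D _ _), w.K_mul_K_neg, ← w.MD]
  simp [below]

theorem colLower_mul_colMul_self (t i : Fin n) :
    (q - q⁻¹) • (w.colLower t i * w.colMul t i) =
      q • w.K (Pi.single (i, t) 1) - q⁻¹ • w.K (-Pi.single (i, t) 1) := by
  rw [colLower, colMul, mul_mul_mul_of_swap (w.K_M _ _), w.K_neg_mul_K, ← w.DM]
  simp [below]

theorem K_mul_colMul (t i k : Fin n) :
    w.K (Pi.single (k, t) 1) * w.colMul t i =
      (if k = i then q else 1) • (w.colMul t i * w.K (Pi.single (k, t) 1)) := by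
  rw [colMul, w.K_mul_MK]
  rcases eq_or_ne k i with rfl | h
  · simp
  · simp [h, h.symm]

theorem K_mul_colLower (t i k : Fin n) :
    w.K (Pi.single (k, t) 1) * w.colLower t i =
      (if k = i then q⁻¹ else 1) • (w.colLower t i * w.K (Pi.single (k, t) 1)) := by
  rw [colLower, w.K_mul_DK]
  rcases eq_or_ne k i with rfl | h
  · simp
  · simp [h, h.symm]

theorem K_mul_colMul_mul_colLower (t : Fin n) {i s k : Fin n} (hi : k ≠ i) (hs : k ≠ s) :
    w.K (Pi.single (k, t) 1) * (w.colMul t i * w.colLower t s) =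
      w.colMul t i * w.colLower t s * w.K (Pi.single (k, t) 1) := by
  rw [← mul_assoc, K_mul_colMul, if_neg hi, one_smul, mul_assoc, K_mul_colLower, if_neg hs,
    one_smul, mul_assoc]

theorem colTransfer_row (hq : q ≠ 0) (t i : Fin n) {j k : Fin n} (h : j < k) :
    w.colTransfer t i j * w.colTransfer t i k =
      q • (w.colTransfer t i k * w.colTransfer t i j) := by
  rcases lt_trichotomy j i with hj | rfl | hj
  · simp [colTransfer_gt hj]
  · rw [colTransfer_self, colTransfer_lt h, mul_smul_comm, smul_mul_assoc, ← mul_assoc,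
      K_mul_colMul, if_pos rfl, smul_mul_assoc, mul_assoc, K_mul_colLower, if_neg h.ne, one_smul,
      smul_comm, mul_assoc]
  · rw [colTransfer_lt hj, colTransfer_lt (hj.trans h)]
    simp only [mul_smul_comm, smul_mul_assoc]
    rw [mul_mul_mul_of_swap (colLower_mul_colMul_of_lt hq t hj),
      mul_mul_mul_of_swap (colLower_mul_colMul_of_lt hq t (hj.trans h)),
      colLower_mul_colLower hq t h]
    simp only [mul_smul_comm]
    module

theorem colTransfer_col (hq : q ≠ 0) (t : Fin n) {i k : Fin n} (j : Fin n) (h : i < k) :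
    w.colTransfer t i j * w.colTransfer t k j =
      q • (w.colTransfer t k j * w.colTransfer t i j) := by
  rcases lt_trichotomy j k with hj | rfl | hj
  · simp [colTransfer_gt hj]
  · rw [colTransfer_self, colTransfer_lt h, mul_smul_comm, smul_mul_assoc, ← mul_assoc (w.K _),
      K_mul_colMul, if_neg h.ne', one_smul, mul_assoc, mul_assoc, K_mul_colLower, if_pos rfl,
      mul_smul_comm, smul_comm q, smul_smul q, mul_inv_cancel₀ hq, one_smul]
  · rw [colTransfer_lt hj, colTransfer_lt (h.trans hj)]
    simp only [mul_smul_comm, smul_mul_assoc]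
    rw [mul_mul_mul_of_swap (colLower_mul_colMul_of_lt hq t hj),
      mul_mul_mul_of_swap (colLower_mul_colMul_of_lt hq t (h.trans hj)),
      colMul_mul_colMul hq t h]
    simp only [smul_mul_assoc]
    module

theorem colTransfer_comm (hq : q ≠ 0) (t : Fin n) {i s l j : Fin n} (h : i < s) (h' : l < j) :
    w.colTransfer t i j * w.colTransfer t s l = w.colTransfer t s l * w.colTransfer t i j := by
  rcases lt_trichotomy l s with hl | rfl | hl
  · simp [colTransfer_gt hl]
  · rw [colTransfer_self, colTransfer_lt (h.trans h'), mul_smul_comm, smul_mul_assoc,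
      K_mul_colMul_mul_colLower t h.ne' h'.ne]
  · rw [colTransfer_lt hl, colTransfer_lt (h.trans (hl.trans h'))]
    simp only [mul_smul_comm, smul_mul_assoc]
    rw [mul_mul_mul_of_swap (colLower_mul_colMul_of_lt hq t (hl.trans h')),
      mul_mul_mul_of_swap (colLower_mul_colMul_of_lt hq t (h.trans hl)),
      colMul_mul_colMul hq t h, colLower_mul_colLower hq t h']
    simp only [mul_smul_comm, smul_mul_assoc]

theorem colTransfer_cross (hq : q ≠ 0) (t : Fin n) {i s j l : Fin n} (h : i < s) (h' : j < l) :
    w.colTransfer t i j * w.colTransfer t s l = w.colTransfer t s l * w.colTransfer t i j +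
      (q - q⁻¹) • (w.colTransfer t i l * w.colTransfer t s j) := by
  rcases lt_trichotomy j i with hj | rfl | hj
  · simp [colTransfer_gt hj, colTransfer_gt (hj.trans h)]
  · rw [colTransfer_gt h, colTransfer_self]
    rcases lt_trichotomy l s with hl | rfl | hl
    · simp [colTransfer_gt hl]
    · rw [colTransfer_self, w.K_comm]; simp
    · rw [colTransfer_lt hl, mul_smul_comm, smul_mul_assoc,
        K_mul_colMul_mul_colLower t h.ne h'.ne]
      simp
  · rcases lt_trichotomy j s with hs | rfl | hs
    · rw [colTransfer_gt hs, colTransfer_lt hj]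
      rcases lt_trichotomy l s with hl | rfl | hl
      · simp [colTransfer_gt hl]
      · rw [colTransfer_self, mul_smul_comm, smul_mul_assoc,
          K_mul_colMul_mul_colLower t h.ne' hs.ne']
        simp
      · rw [colTransfer_lt hl]
        simp only [mul_smul_comm, smul_mul_assoc, mul_zero, smul_zero, add_zero]
        rw [mul_mul_mul_of_swap (colLower_mul_colMul_of_gt hq t hs),
          mul_mul_mul_of_swap (colLower_mul_colMul_of_lt hq t (h.trans hl)),
          colMul_mul_colMul hq t h, colLower_mul_colLower hq t h']
        simp only [mul_smul_comm, smul_mul_assoc, smul_smul]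
        match_scalars
        field_simp
    · rw [colTransfer_self, colTransfer_lt hj, colTransfer_lt h', colTransfer_lt (hj.trans h')]
      have e1 : (q - q⁻¹) • (w.colMul t i * w.colLower t j) *
          (q - q⁻¹) • (w.colMul t j * w.colLower t l) = (q - q⁻¹) • (w.colMul t i *
          (q • w.K (Pi.single (j, t) 1) - q⁻¹ • w.K (-Pi.single (j, t) 1)) *
            w.colLower t l) := by
        rw [← colLower_mul_colMul_self]
        simp only [mul_smul_comm, smul_mul_assoc, mul_assoc]
      have e2 : (q - q⁻¹) • (w.colMul t j * w.colLower t l) *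
          (q - q⁻¹) • (w.colMul t i * w.colLower t j) = (q - q⁻¹) • q⁻¹ • (w.colMul t i *
          (w.K (Pi.single (j, t) 1) - w.K (-Pi.single (j, t) 1)) * w.colLower t l) := by
        rw [← colMul_mul_colLower_self]
        simp only [mul_smul_comm, smul_mul_assoc]
        have e3 : w.colLower t l * w.colLower t j =
            q⁻¹ • (w.colLower t j * w.colLower t l) := by
          rw [colLower_mul_colLower hq t h', smul_smul, inv_mul_cancel₀ hq, one_smul]
        have e4 : w.colMul t j * w.colMul t i = q⁻¹ • (w.colMul t i * w.colMul t j) := by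
          rw [colMul_mul_colMul hq t h, smul_smul, inv_mul_cancel₀ hq, one_smul]
        rw [mul_mul_mul_of_swap (colLower_mul_colMul_of_lt hq t (hj.trans h')), e3, e4]
        simp only [mul_smul_comm, smul_mul_assoc, smul_smul, mul_assoc]
        match_scalars
        field_simp
      have e5 : w.colLower t l * w.K (Pi.single (j, t) 1) =
          w.K (Pi.single (j, t) 1) * w.colLower t l := by
        rw [K_mul_colLower, if_neg h'.ne, one_smul]
      rw [e1, e2, smul_mul_assoc, mul_assoc (w.colMul t i) (w.colLower t l),
        e5, ← mul_assoc (w.colMul t i) (w.K _)]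
      simp only [mul_sub, sub_mul, mul_smul_comm, smul_mul_assoc]
      module
    · rw [colTransfer_lt hj, colTransfer_lt (hs.trans h'), colTransfer_lt (hj.trans h'),
        colTransfer_lt hs]
      simp only [mul_smul_comm, smul_mul_assoc]
      rw [mul_mul_mul_of_swap (colLower_mul_colMul_of_lt hq t hs),
        mul_mul_mul_of_swap (colLower_mul_colMul_of_lt hq t (h.trans (hs.trans h'))),
        mul_mul_mul_of_swap (colLower_mul_colMul_of_lt hq t (hs.trans h')),
        colMul_mul_colMul hq t h, colLower_mul_colLower hq t h']
      simp only [mul_smul_comm, smul_mul_assoc, smul_smul]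
      match_scalars
      field_simp
      ring

theorem isQuantumMatrix_colTransfer (hq : q ≠ 0) (t : Fin n) :
    IsQuantumMatrix q (w.colTransfer t) :=
  ⟨colTransfer_row hq t, colTransfer_col hq t, colTransfer_comm hq t, colTransfer_cross hq t⟩

theorem colTransfer_mul_colMul_row (hq : q ≠ 0) (t i k : Fin n) :
    w.colTransfer t i k * w.colMul t i = q • (w.colMul t i * w.colTransfer t i k) := by
  rcases lt_trichotomy k i with hk | rfl | hk
  · simp [colTransfer_gt hk]
  · rw [colTransfer_self, K_mul_colMul, if_pos rfl]
  · rw [colTransfer_lt hk, smul_mul_assoc, mul_assoc, colLower_mul_colMul_of_lt hq t hk]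
    simp only [mul_smul_comm]
    module

theorem colTransfer_mul_colMul_comm (hq : q ≠ 0) (t k : Fin n) {i s : Fin n} (h : i < s) :
    w.colTransfer t s k * w.colMul t i = w.colMul t i * w.colTransfer t s k := by
  rcases lt_trichotomy k s with hk | rfl | hk
  · simp [colTransfer_gt hk]
  · rw [colTransfer_self, K_mul_colMul, if_neg h.ne', one_smul]
  · rw [colTransfer_lt hk, smul_mul_assoc, mul_assoc,
      colLower_mul_colMul_of_lt hq t (h.trans hk), mul_smul_comm, mul_smul_comm, ← mul_assoc,
      ← mul_assoc, colMul_mul_colMul hq t h, smul_mul_assoc]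

theorem colTransfer_mul_colMul_cross (hq : q ≠ 0) (t k : Fin n) {i s : Fin n} (h : i < s) :
    w.colTransfer t i k * w.colMul t s = w.colMul t s * w.colTransfer t i k +
      (q - q⁻¹) • (w.colMul t i * w.colTransfer t s k) := by
  have e4 : w.colMul t s * w.colMul t i = q⁻¹ • (w.colMul t i * w.colMul t s) := by
    rw [colMul_mul_colMul hq t h, smul_smul, inv_mul_cancel₀ hq, one_smul]
  rcases lt_trichotomy k i with hk | rfl | hk
  · simp [colTransfer_gt hk, colTransfer_gt (hk.trans h)]
  · rw [colTransfer_self, colTransfer_gt h, K_mul_colMul, if_neg h.ne]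
    simp
  · rw [colTransfer_lt hk, smul_mul_assoc, mul_assoc, mul_smul_comm, ← mul_assoc (w.colMul t s),
      e4]
    rcases lt_trichotomy k s with hs | rfl | hs
    · rw [colTransfer_gt hs, colLower_mul_colMul_of_gt hq t hs]
      simp [mul_assoc]
    · have e1 := colLower_mul_colMul_self (w := w) t k
      have e2 := colMul_mul_colLower_self (w := w) t k
      rw [← mul_smul_comm, e1, colTransfer_self, smul_mul_assoc, smul_comm, mul_assoc,
        ← mul_smul_comm (q - q⁻¹) (w.colMul t i), e2]
      simp only [mul_sub, mul_smul_comm]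
      module
    · rw [colTransfer_lt hs, colLower_mul_colMul_of_lt hq t hs]
      simp only [mul_smul_comm, smul_mul_assoc, mul_assoc]
      match_scalars
      field_simp
      ring

end QWeyl
end QuantumMatrix

namespace QuantumMatrix
namespace QWeyl

variable {n : ℕ} {q : ℂ} {B : Type*} [Ring B] [Algebra ℂ B]
variable (w : QWeyl (Fin n × Fin n) q B)

/-! ### Right multiplication as an element of the `q`-Weyl algebra -/

/-- Right multiplication by `Z_ij` on the monomials in the first `m` columns; it is `0` when
`Z_ij` is not in one of these columns. -/
noncomputable def truncMul : ℕ → Fin n → Fin n → B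
  | 0 => fun _ _ => 0
  | m + 1 => fun i j =>
    if h : m < n then
      ∑ s, w.colTransfer ⟨m, h⟩ i s * truncMul m s j + if j.val = m then w.colMul ⟨m, h⟩ i else 0
    else truncMul m i j

variable {w}

theorem truncMul_succ (t i j : Fin n) :
    w.truncMul (t + 1) i j =
      ∑ s, w.colTransfer t i s * w.truncMul t s j + if j = t then w.colMul t i else 0 := by
  simp [truncMul, Fin.ext_iff]

theorem truncMul_eq_zero {m : ℕ} (i : Fin n) {j : Fin n} (h : m ≤ j.val) :
    w.truncMul m i j = 0 := by
  induction m generalizing i with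
  | zero => rfl
  | succ m ih =>
    have hj : ¬ j.val = m := by omega
    simp [truncMul, ih _ (by omega : m ≤ j.val), hj]

theorem truncMul_self (i j : Fin n) : w.truncMul (j + 1) i j = w.colMul j i := by
  simp [truncMul_succ, truncMul_eq_zero]

theorem truncMul_of_lt {t j : Fin n} (i : Fin n) (h : j < t) :
    w.truncMul (t + 1) i j = ∑ s, w.colTransfer t i s * w.truncMul t s j := by
  simp [truncMul_succ, h.ne]

theorem truncMul_of_gt {t j : Fin n} (i : Fin n) (h : t < j) : w.truncMul (t + 1) i j = 0 :=
  truncMul_eq_zero i h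

theorem truncMul_map {B' : Type*} [Ring B'] [Algebra ℂ B'] (f : B →ₐ[ℂ] B') (m : ℕ)
    (i j : Fin n) : (w.map f).truncMul m i j = f (w.truncMul m i j) := by
  have hM : ∀ t i, (w.map f).colMul t i = f (w.colMul t i) := fun t i => by
    simp [colMul, map]
  have hD : ∀ t i, (w.map f).colLower t i = f (w.colLower t i) := fun t i => by
    simp [colLower, map]
  have hT : ∀ t i s, (w.map f).colTransfer t i s = f (w.colTransfer t i s) := fun t i s => by
    unfold colTransfer
    rw [hM, hD]
    split_ifs
    · simp only [map_smul, map_mul]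
    · rfl
    · simp
  induction m generalizing i with
  | zero => simp [truncMul]
  | succ m ih =>
    unfold truncMul
    split_ifs <;> simp [ih, hT, hM]

theorem commute_truncMul {z : B} {m : ℕ}
    (hM : ∀ t i : Fin n, t.val < m → Commute z (w.colMul t i))
    (hD : ∀ t i : Fin n, t.val < m → Commute z (w.colLower t i))
    (hK : ∀ t i : Fin n, t.val < m → Commute z (w.K (Pi.single (i, t) 1))) (i j : Fin n) :
    Commute z (w.truncMul m i j) := by
  induction m generalizing i with
  | zero => exact Commute.zero_right z
  | succ m ih =>
    have ih' := fun i => ih (fun t i h => hM t i (by omega)) (fun t i h => hD t i (by omega))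
      (fun t i h => hK t i (by omega)) i
    unfold truncMul
    split_ifs with h hj
    · refine (Commute.sum_right _ _ _ fun s _ => ?_).add_right (hM _ _ (Nat.lt_succ_self m))
      refine Commute.mul_right ?_ (ih' s)
      unfold colTransfer
      split_ifs
      · exact ((hM _ _ (Nat.lt_succ_self m)).mul_right
          (hD _ _ (Nat.lt_succ_self m))).smul_right _
      · exact hK _ _ (Nat.lt_succ_self m)
      · exact Commute.zero_right z
    · rw [add_zero]
      refine Commute.sum_right _ _ _ fun s _ => ?_
      refine Commute.mul_right ?_ (ih' s)
      unfold colTransfer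
      split_ifs
      · exact ((hM _ _ (Nat.lt_succ_self m)).mul_right
          (hD _ _ (Nat.lt_succ_self m))).smul_right _
      · exact hK _ _ (Nat.lt_succ_self m)
      · exact Commute.zero_right z
    · exact ih' i

theorem commute_colMul_truncMul (hq : q ≠ 0) {m : ℕ} {t : Fin n} (h : m ≤ t.val)
    (k i j : Fin n) : Commute (w.colMul t k) (w.truncMul m i j) := by
  refine commute_truncMul (fun r a hr => ?_) (fun r a hr => ?_) (fun r a hr => ?_) i j <;>
  · have hrt : r ≠ t := by rintro rfl; omega
    simp [Commute, SemiconjBy, colMul, colLower, w.MK_mul_MK hq (k, t) (a, r),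
      w.DK_mul_MK hq (p := (a, r)) (r := (k, t)) (by simp [hrt]), w.K_mul_MK, below, hrt,
      hrt.symm]

theorem commute_colTransfer_truncMul (hq : q ≠ 0) {m : ℕ} {t : Fin n} (h : m ≤ t.val)
    (k l i j : Fin n) : Commute (w.colTransfer t k l) (w.truncMul m i j) := by
  unfold colTransfer
  split_ifs
  · refine ((commute_colMul_truncMul hq h k i j).mul_left ?_).smul_left _
    refine commute_truncMul (fun r a hr => ?_) (fun r a hr => ?_) (fun r a hr => ?_) i j <;>
    · have hrt : r ≠ t := by rintro rfl; omega
      simp [Commute, SemiconjBy, colMul, colLower, w.DK_mul_DK hq (l, t) (a, r),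
        w.DK_mul_MK hq (r := (a, r)) (p := (l, t)) (by simp [hrt.symm]), w.K_mul_DK, below, hrt,
        hrt.symm]
  · refine commute_truncMul (fun r a hr => ?_) (fun r a hr => ?_) (fun r a hr => ?_) i j <;>
    · have hrt : r ≠ t := by rintro rfl; omega
      simp [Commute, SemiconjBy, colMul, colLower, w.K_mul_MK, w.K_mul_DK, hrt,
        w.K_comm (Pi.single (k, t) 1)]
  · exact Commute.zero_left _

/-- Adding a column multiplies the previous quantum matrix by the transfer matrix of that column
and fills in the new column, whose relations with the transfer matrix give the remaining ones. -/
theorem isQuantumMatrix_truncMul (hq : q ≠ 0) {m : ℕ} (hm : m ≤ n) :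
    IsQuantumMatrix q (w.truncMul m) := by
  induction m with
  | zero => constructor <;> simp [truncMul]
  | succ m ih =>
    obtain ⟨t, rfl⟩ : ∃ t : Fin n, t.val = m := ⟨⟨m, hm⟩, rfl⟩
    have hP := (isQuantumMatrix_colTransfer (w := w) hq t).mul hq (ih t.isLt.le)
      fun i j k l => commute_colTransfer_truncMul hq le_rfl i j k l
    have hL := fun s i j => commute_colMul_truncMul (w := w) hq (le_refl t.val) s i j
    constructor
    · intro i j k h
      rcases lt_trichotomy k t with hk | rfl | hk
      · simpa only [truncMul_of_lt _ hk, truncMul_of_lt _ (h.trans hk)] using hP.row i h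
      · rw [truncMul_self, truncMul_of_lt _ h, Finset.sum_mul, Finset.mul_sum, Finset.smul_sum]
        refine Finset.sum_congr rfl fun s _ => ?_
        rw [mul_assoc, ← (hL i s j).eq, ← mul_assoc, colTransfer_mul_colMul_row hq,
          smul_mul_assoc, mul_assoc]
      · simp [truncMul_of_gt _ hk]
    · intro i k j h
      rcases lt_trichotomy j t with hj | rfl | hj
      · simpa only [truncMul_of_lt _ hj] using hP.col j h
      · simp only [truncMul_self, colMul_mul_colMul hq _ h]
      · simp [truncMul_of_gt _ hj]
    · intro i s l j h h'
      rcases lt_trichotomy j t with hj | rfl | hj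
      · simpa only [truncMul_of_lt _ hj, truncMul_of_lt _ (h'.trans hj)] using hP.comm h h'
      · rw [truncMul_self, truncMul_of_lt _ h', Finset.sum_mul, Finset.mul_sum]
        refine Finset.sum_congr rfl fun k _ => ?_
        rw [mul_assoc _ _ (w.colMul j i), ← (hL i k l).eq, ← mul_assoc, ← mul_assoc,
          colTransfer_mul_colMul_comm hq _ _ h]
      · simp [truncMul_of_gt _ hj]
    · intro i s j l h h'
      rcases lt_trichotomy l t with hl | rfl | hl
      · simpa only [truncMul_of_lt _ hl, truncMul_of_lt _ (h'.trans hl)] using hP.cross h h'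
      · rw [truncMul_self, truncMul_self, truncMul_of_lt _ h', truncMul_of_lt _ h',
          Finset.sum_mul, Finset.mul_sum, Finset.mul_sum, Finset.smul_sum,
          ← Finset.sum_add_distrib]
        refine Finset.sum_congr rfl fun k _ => ?_
        rw [mul_assoc, ← (hL s k j).eq, ← mul_assoc, colTransfer_mul_colMul_cross hq _ _ h,
          add_mul, smul_mul_assoc, mul_assoc, mul_assoc]
      · simp [truncMul_of_gt _ hl]

variable (w)

/-- The element of the `q`-Weyl algebra that will turn out to be right multiplication by
`Z_ij`. -/
noncomputable def mulGen (i j : Fin n) : B := w.truncMul n i j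

end QWeyl
end QuantumMatrix

namespace QuantumMatrix

variable {n : ℕ} {q : ℂ}

/-! ### The operators on a space with a basis of monomials -/

theorem unitExpo_apply (i j k l : Fin n) :
    unitExpo i j k l = if (i, j) = (k, l) then 1 else 0 := by
  unfold unitExpo
  rcases eq_or_ne i k with rfl | hi
  · rcases eq_or_ne j l with rfl | hj
    · simp
    · simp [hj, hj.symm]
  · simp [hi, hi.symm]

@[simp] theorem unitExpo_self (i j : Fin n) : unitExpo i j i j = 1 := by simp [unitExpo_apply]

theorem unitExpo_of_ne {i j k l : Fin n} (h : (i, j) ≠ (k, l)) : unitExpo i j k l = 0 := by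
  simp [unitExpo_apply, h]

theorem add_unitExpo_sub (a : Expo n) (i j : Fin n) : a + unitExpo i j - unitExpo i j = a := by
  ext k l; simp

theorem exists_eq_add_unitExpo {a : Expo n} {i j : Fin n} (h : a i j ≠ 0) :
    ∃ c, a = c + unitExpo i j := by
  refine ⟨a - unitExpo i j, ?_⟩
  ext k l
  simp only [Pi.add_apply, Pi.sub_apply, unitExpo_apply]
  split_ifs with h'
  · obtain ⟨rfl, rfl⟩ := Prod.mk.inj h'
    omega
  · simp

/-- The value of the integer weight `x` on the exponent `a`. -/
def weight (x : Fin n × Fin n → ℤ) (a : Expo n) : ℤ := ∑ i, ∑ j, x (i, j) * a i j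

theorem weight_add_left (x y : Fin n × Fin n → ℤ) (a : Expo n) :
    weight (x + y) a = weight x a + weight y a := by
  simp [weight, add_mul, Finset.sum_add_distrib]

theorem weight_add_right (x : Fin n × Fin n → ℤ) (a c : Expo n) :
    weight x (a + c) = weight x a + weight x c := by
  simp [weight, mul_add, Finset.sum_add_distrib]

theorem weight_neg (x : Fin n × Fin n → ℤ) (a : Expo n) : weight (-x) a = -weight x a := by
  simp [weight]

theorem weight_smul (m : ℤ) (x : Fin n × Fin n → ℤ) (a : Expo n) :
    weight (m • x) a = m * weight x a := by
  simp [weight, Finset.mul_sum, mul_assoc]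

theorem weight_single (p : Fin n × Fin n) (a : Expo n) :
    weight (Pi.single p 1) a = a p.1 p.2 := by
  obtain ⟨i, j⟩ := p
  unfold weight
  rw [Finset.sum_eq_single i, Finset.sum_eq_single j]
  · simp
  · intro l _ hl; simp [hl]
  · simp
  · intro k _ hk; simp [hk]
  · simp

theorem weight_unitExpo (x : Fin n × Fin n → ℤ) (i j : Fin n) :
    weight x (unitExpo i j) = x (i, j) := by
  unfold weight
  rw [Finset.sum_eq_single i, Finset.sum_eq_single j]
  · simp
  · intro l _ hl; simp [unitExpo_apply, hl.symm]
  · simp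
  · intro k _ hk; simp [unitExpo_apply, hk.symm]
  · simp

theorem qnumL_mul (hq : q ≠ 0) (a : ℕ) :
    (q - q⁻¹) * qnumL q a = q ^ (a : ℤ) - q ^ (-(a : ℤ)) := by
  have h : ∀ m : ℕ, (q - q⁻¹) * ∑ k ∈ Finset.range m, q ^ (2 * (k : ℤ) - a + 1) =
      q ^ (2 * (m : ℤ) - a) - q ^ (-(a : ℤ)) := by
    intro m
    induction m with
    | zero => simp
    | succ m ih =>
      rw [Finset.sum_range_succ, mul_add, ih]
      have e1 : q ^ (2 * ((m + 1 : ℕ) : ℤ) - a) = q ^ (2 * (m : ℤ) - a) * (q * q) := by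
        rw [← sq, ← zpow_natCast q 2, ← zpow_add₀ hq]
        congr 1
        push_cast
        ring
      have e2 : q ^ (2 * (m : ℤ) - a + 1) = q ^ (2 * (m : ℤ) - a) * q := zpow_add_one₀ hq _
      rw [e1, e2]
      field_simp
      ring
  rw [qnumL, h, two_mul, add_sub_cancel_right]

theorem qnumL_zero : qnumL q 0 = 0 := by simp [qnumL]

theorem qnumK_zero : qnumK q 0 = 0 := by simp [qnumK]

section Model

variable {E : Type*} [AddCommGroup E] [Module ℂ E] (b : Module.Basis (Expo n) ℂ E)

/-- `Z^a ↦ Z^{a + e_p}` -/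
noncomputable def raise (p : Fin n × Fin n) : Module.End ℂ E :=
  b.constr ℂ fun a => b (a + unitExpo p.1 p.2)

/-- `Z^a ↦ ν(a_p) Z^{a - e_p}` -/
noncomputable def lower (ν : ℕ → ℂ) (p : Fin n × Fin n) : Module.End ℂ E :=
  b.constr ℂ fun a => ν (a p.1 p.2) • b (a - unitExpo p.1 p.2)

/-- `Z^a ↦ q^{⟨x, a⟩} Z^a` -/
noncomputable def torus (q : ℂ) (x : Fin n × Fin n → ℤ) : Module.End ℂ E :=
  b.constr ℂ fun a => q ^ weight x a • b a

@[simp] theorem raise_basis (p : Fin n × Fin n) (a : Expo n) :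
    raise b p (b a) = b (a + unitExpo p.1 p.2) := by simp [raise]

@[simp] theorem lower_basis (ν : ℕ → ℂ) (p : Fin n × Fin n) (a : Expo n) :
    lower b ν p (b a) = ν (a p.1 p.2) • b (a - unitExpo p.1 p.2) := by simp [lower]

@[simp] theorem torus_basis (x : Fin n × Fin n → ℤ) (a : Expo n) :
    torus b q x (b a) = q ^ weight x a • b a := by simp [torus]

/-- The operators on a space with a basis of monomials form a `q`-Weyl system. -/
noncomputable def weylModel (hq : q ≠ 0) : QWeyl (Fin n × Fin n) q (Module.End ℂ E) where
  M := raise b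
  D := lower b (qnumL q)
  K := torus b q
  K_zero := by
    refine b.ext fun a => ?_
    simp [weight]
  K_add x y := by
    refine b.ext fun a => ?_
    simp [weight_add_left, zpow_add₀ hq, smul_smul, mul_comm]
  K_M x p := by
    refine b.ext fun a => ?_
    simp [weight_add_right, weight_unitExpo, zpow_add₀ hq, smul_smul, mul_comm]
  K_D x p := by
    refine b.ext fun a => ?_
    by_cases h : a p.1 p.2 = 0
    · simp [h, qnumL_zero]
    · obtain ⟨c, rfl⟩ := exists_eq_add_unitExpo h
      simp only [Module.End.mul_apply, LinearMap.smul_apply, lower_basis, torus_basis, map_smul,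
        add_unitExpo_sub, weight_add_right, weight_unitExpo, smul_smul, Prod.mk.eta]
      rw [← mul_assoc, ← zpow_add₀ hq, mul_comm, neg_add_cancel_comm_assoc]
  M_comm p r := by
    refine b.ext fun a => ?_
    simp [add_right_comm]
  D_comm p r := by
    refine b.ext fun a => ?_
    rcases eq_or_ne p r with rfl | h
    · rfl
    · simp [unitExpo_of_ne h, unitExpo_of_ne h.symm, smul_smul, mul_comm, tsub_right_comm]
  MD_comm p r h := by
    refine b.ext fun a => ?_
    have e : a - unitExpo r.1 r.2 + unitExpo p.1 p.2 =
        a + unitExpo p.1 p.2 - unitExpo r.1 r.2 := by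
      ext k l
      simp only [Pi.add_apply, Pi.sub_apply, unitExpo_apply]
      rcases eq_or_ne p (k, l) with rfl | hp
      · simp [h.symm]
      · simp [hp]
    simp [unitExpo_of_ne h, e]
  MD p := by
    refine b.ext fun a => ?_
    by_cases h : a p.1 p.2 = 0
    · simp [h, qnumL_zero, weight_single, weight_neg]
    · obtain ⟨c, rfl⟩ := exists_eq_add_unitExpo h
      simp only [Module.End.mul_apply, LinearMap.smul_apply, lower_basis, map_smul,
        add_unitExpo_sub, smul_smul, raise_basis, LinearMap.sub_apply, torus_basis,
        weight_neg, weight_single, ← sub_smul]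
      rw [qnumL_mul hq]
  DM p := by
    refine b.ext fun a => ?_
    simp only [Module.End.mul_apply, LinearMap.smul_apply, lower_basis, raise_basis,
      add_unitExpo_sub, smul_smul, LinearMap.sub_apply, torus_basis,
      weight_neg, weight_single, ← sub_smul]
    rw [qnumL_mul hq]
    simp [zpow_add₀ hq, mul_comm]

theorem weylModel_map {E' : Type*} [AddCommGroup E'] [Module ℂ E'] (hq : q ≠ 0) (e : E ≃ₗ[ℂ] E') :
    weylModel (b.map e) hq = (weylModel b hq).map (e.conjAlgEquiv ℂ : _ →ₐ[ℂ] _) := by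
  have h1 : ∀ p, raise (b.map e) p = e.conjAlgEquiv ℂ (raise b p) := fun p =>
    (b.map e).ext fun a => by rw [raise_basis]; simp
  have h2 : ∀ p, lower (b.map e) (qnumL q) p = e.conjAlgEquiv ℂ (lower b (qnumL q) p) := fun p =>
    (b.map e).ext fun a => by rw [lower_basis]; simp
  have h3 : ∀ x, torus (b.map e) q x = e.conjAlgEquiv ℂ (torus b q x) := fun x =>
    (b.map e).ext fun a => by rw [torus_basis]; simp
  simp only [weylModel, QWeyl.map, QWeyl.mk.injEq]
  exact ⟨funext h1, funext h2, funext h3⟩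

end Model
end QuantumMatrix

namespace QuantumMatrix

variable {n : ℕ} {q : ℂ}

/-! ### The ordered monomials are linearly independent -/

section Leading

variable {E : Type*} [AddCommGroup E] [Module ℂ E] (b : Module.Basis (Expo n) ℂ E)

/-- Right multiplication by `Z_ij` of a monomial that ends before the node `(i, j)`, or at it,
only raises the exponent. -/
theorem mulGen_basis (hq : q ≠ 0) {i j : Fin n} {a : Expo n} (h1 : ∀ k, i < k → a k j = 0)
    (h2 : ∀ k l, j < l → a k l = 0) :
    (weylModel b hq).mulGen i j (b a) = b (a + unitExpo i j) := by
  have key : ∀ m, j.val + 1 ≤ m → m ≤ n →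
      (weylModel b hq).truncMul m i j (b a) = b (a + unitExpo i j) := by
    intro m hm
    induction m, hm using Nat.le_induction with
    | base =>
      intro _
      have hw : weight (QWeyl.below i j) a = 0 := by
        refine Finset.sum_eq_zero fun k _ => Finset.sum_eq_zero fun l _ => ?_
        unfold QWeyl.below
        split_ifs with h
        · obtain ⟨rfl, h⟩ := h
          simp [h1 k h]
        · simp
      rw [QWeyl.truncMul_self]
      simp [QWeyl.colMul, weylModel, hw]
    | succ m hm ih =>
      intro hmn
      obtain ⟨t, rfl⟩ : ∃ t : Fin n, t.val = m := ⟨⟨m, hmn⟩, rfl⟩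
      have hjt : j < t := hm
      have hT : ∀ s, (weylModel b hq).colTransfer t i s (b a) = if i = s then b a else 0 := by
        intro s
        unfold QWeyl.colTransfer
        rcases lt_trichotomy i s with h | rfl | h
        · simp [h, h.ne, QWeyl.colLower, weylModel, h2 s t hjt, qnumL_zero]
        · simp [weylModel, weight_single, h2 i t hjt]
        · simp [h.not_gt, h.ne']
      rw [QWeyl.truncMul_of_lt i hjt, ← ih t.isLt.le, LinearMap.sum_apply]
      have e : ∀ s, ((weylModel b hq).colTransfer t i s * (weylModel b hq).truncMul t s j) (b a) =
          if i = s then (weylModel b hq).truncMul t s j (b a) else 0 := by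
        intro s
        rw [(QWeyl.commute_colTransfer_truncMul hq le_rfl i s s j).eq, Module.End.mul_apply, hT]
        split_ifs <;> simp
      simp [e]
  exact key n j.isLt le_rfl

end Leading

theorem gen_row (i : Fin n) {j k : Fin n} (h : j < k) :
    gen q i j * gen q i k = q⁻¹ • (gen q i k * gen q i j) := by
  simpa [gen] using RingQuot.mkAlgHom_rel ℂ (Rel.row (q := q) i j k h)

theorem gen_col {i k : Fin n} (j : Fin n) (h : i < k) :
    gen q i j * gen q k j = q⁻¹ • (gen q k j * gen q i j) := by
  simpa [gen] using RingQuot.mkAlgHom_rel ℂ (Rel.col (q := q) i k j h)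

theorem gen_comm {i s t j : Fin n} (h : i < s) (h' : t < j) :
    gen q i j * gen q s t = gen q s t * gen q i j := by
  simpa [gen] using RingQuot.mkAlgHom_rel ℂ (Rel.comm (q := q) i j s t h h')

theorem gen_cross {i s j t : Fin n} (h : i < s) (h' : j < t) :
    gen q i j * gen q s t =
      gen q s t * gen q i j - (q - q⁻¹) • (gen q i t * gen q s j) := by
  simpa [gen] using RingQuot.mkAlgHom_rel ℂ (Rel.cross (q := q) i j s t h h')

/-- The formal space of ordered monomials. -/
abbrev FormalSpan (n : ℕ) : Type := Expo n →₀ ℂ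

/-- The basis of formal monomials. -/
noncomputable def formalBasis (n : ℕ) : Module.Basis (Expo n) ℂ (FormalSpan n) :=
  Finsupp.basisSingleOne

/-- The right action of the quadratic algebra on formal ordered monomials. -/
noncomputable def rightAction (hq : q ≠ 0) : Alg n q →ₐ[ℂ] (Module.End ℂ (FormalSpan n))ᵐᵒᵖ :=
  RingQuot.liftAlgHom ℂ
    ⟨FreeAlgebra.lift ℂ fun p : Fin n × Fin n =>
      MulOpposite.op ((weylModel (formalBasis n) hq).mulGen p.1 p.2), by
        have hX := QWeyl.isQuantumMatrix_truncMul (w := weylModel (formalBasis n) hq) hq le_rfl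
        intro x y h
        induction h with
        | row i j k h =>
          simp only [map_mul, map_smul, FreeAlgebra.lift_ι_apply, ← MulOpposite.op_mul,
            ← MulOpposite.op_smul, QWeyl.mulGen]
          rw [hX.row i h, smul_smul, inv_mul_cancel₀ hq, one_smul]
        | col i k j h =>
          simp only [map_mul, map_smul, FreeAlgebra.lift_ι_apply, ← MulOpposite.op_mul,
            ← MulOpposite.op_smul, QWeyl.mulGen]
          rw [hX.col j h, smul_smul, inv_mul_cancel₀ hq, one_smul]
        | comm i j s t h h' =>
          simp only [map_mul, FreeAlgebra.lift_ι_apply, ← MulOpposite.op_mul, QWeyl.mulGen]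
          rw [hX.comm h h']
        | cross i j s t h h' =>
          simp only [map_mul, map_smul, map_sub, FreeAlgebra.lift_ι_apply, ← MulOpposite.op_mul,
            ← MulOpposite.op_smul, ← MulOpposite.op_sub, QWeyl.mulGen]
          rw [hX.cross h h', hX.comm h h']
          exact congrArg MulOpposite.op
            (add_sub_cancel_right (G := Module.End ℂ (FormalSpan n)) _ _).symm⟩

theorem rightAction_gen (hq : q ≠ 0) (i j : Fin n) :
    rightAction hq (gen q i j) =
      MulOpposite.op ((weylModel (formalBasis n) hq).mulGen i j) := by
  simp [rightAction, gen]

/-- The vector to which an element of the algebra moves the formal monomial `1`. -/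
noncomputable def formalValue (hq : q ≠ 0) : Alg n q →ₗ[ℂ] FormalSpan n where
  toFun z := (rightAction hq z).unop (formalBasis n 0)
  map_add' := by simp
  map_smul' := by simp

theorem formalValue_one (hq : q ≠ 0) : formalValue hq (1 : Alg n q) = formalBasis n 0 := by
  simp [formalValue]

theorem formalValue_mul_gen (hq : q ≠ 0) (z : Alg n q) (i j : Fin n) :
    formalValue hq (z * gen q i j) =
      (weylModel (formalBasis n) hq).mulGen i j (formalValue hq z) := by
  simp [formalValue, rightAction_gen]

theorem formalValue_mul_gen_pow (hq : q ≠ 0) {z : Alg n q} {i j : Fin n} {c : Expo n}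
    (hz : formalValue hq z = formalBasis n c) (h1 : ∀ k, i < k → c k j = 0)
    (h2 : ∀ k l, j < l → c k l = 0) (m : ℕ) :
    formalValue hq (z * gen q i j ^ m) = formalBasis n (c + m • unitExpo i j) := by
  induction m with
  | zero => simpa using hz
  | succ m ih =>
    rw [pow_succ, ← mul_assoc, formalValue_mul_gen, ih, mulGen_basis, add_assoc, succ_nsmul]
    · intro k hk
      simp [h1 k hk, unitExpo_apply, hk.ne]
    · intro k l hl
      simp [h2 k l hl, unitExpo_apply, hl.ne]

theorem formalValue_mul_column (hq : q ≠ 0) (a : Expo n) (j : Fin n) (l : List (Fin n))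
    (hl : l.Pairwise (· < ·)) {z : Alg n q} {c : Expo n}
    (hz : formalValue hq z = formalBasis n c) (h1 : ∀ i ∈ l, ∀ k, i < k → c k j = 0)
    (h2 : ∀ k l, j < l → c k l = 0) :
    formalValue hq (z * (l.map fun i => gen q i j ^ a i j).prod) =
      formalBasis n (c + (l.map fun i => a i j • unitExpo i j).sum) := by
  induction l generalizing z c with
  | nil => simpa using hz
  | cons i l ih =>
    rw [List.pairwise_cons] at hl
    simp only [List.map_cons, List.prod_cons, List.sum_cons, ← mul_assoc, ← add_assoc]
    refine ih hl.2 (formalValue_mul_gen_pow hq hz (h1 i (by simp)) h2 _) ?_ ?_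
    · intro s hs k hk
      simp [h1 s (by simp [hs]) k hk, unitExpo_apply, ((hl.1 s hs).trans hk).ne]
    · intro k r hr
      simp [h2 k r hr, unitExpo_apply, hr.ne]

theorem formalValue_mul_columns (hq : q ≠ 0) (a : Expo n) (l : List (Fin n))
    (hl : l.Pairwise (· < ·)) {z : Alg n q} {c : Expo n}
    (hz : formalValue hq z = formalBasis n c) (h : ∀ j ∈ l, ∀ k r, j ≤ r → c k r = 0) :
    formalValue hq (z * (l.map fun j =>
        ((List.finRange n).map fun i => gen q i j ^ a i j).prod).prod) =
      formalBasis n (c + (l.map fun j =>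
        ((List.finRange n).map fun i => a i j • unitExpo i j).sum).sum) := by
  induction l generalizing z c with
  | nil => simpa using hz
  | cons j l ih =>
    rw [List.pairwise_cons] at hl
    simp only [List.map_cons, List.prod_cons, List.sum_cons, ← mul_assoc, ← add_assoc]
    refine ih hl.2 (formalValue_mul_column hq a j _ (List.pairwise_lt_finRange n) hz ?_ ?_) ?_
    · exact fun i _ k _ => h j (by simp) k j le_rfl
    · exact fun k r hr => h j (by simp) k r hr.le
    · intro t ht k r hr
      have hjr : j < r := (hl.1 t ht).trans_le hr
      rw [Pi.add_apply, Pi.add_apply, h j (by simp) k r hjr.le, zero_add]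
      induction List.finRange n with
      | nil => rfl
      | cons i l ih =>
        rw [List.map_cons, List.sum_cons, Pi.add_apply, Pi.add_apply, ih]
        simp [unitExpo_apply, hjr.ne]

/-- The ordered monomial `Z^a` moves `1` to the formal monomial with exponent `a`. -/
theorem formalValue_mono (hq : q ≠ 0) (a : Expo n) :
    formalValue hq (mono q a) = formalBasis n a := by
  have h := formalValue_mul_columns hq a (List.finRange n) (List.pairwise_lt_finRange n)
    (formalValue_one hq) (by simp)
  rw [one_mul, zero_add] at h
  rw [mono, h]
  congr 1
  simp only [← List.ofFn_eq_map, List.sum_ofFn]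
  ext k l
  simp only [Finset.sum_apply, Pi.smul_apply, smul_eq_mul]
  rw [Finset.sum_eq_single l, Finset.sum_eq_single k]
  · simp
  · intro i _ hi; simp [unitExpo_apply, hi]
  · simp
  · intro j _ hj
    refine Finset.sum_eq_zero fun i _ => ?_
    simp [unitExpo_apply, hj]
  · simp

/-! ### The ordered monomials span -/

section Span

variable {A : Type*} [Ring A] [Algebra ℂ A]

theorem adjoin_le_of_mul_mem (P : Submodule ℂ A) (s : Set A) (h1 : (1 : A) ∈ P)
    (hP : ∀ x ∈ P, ∀ g ∈ s, x * g ∈ P) : Subalgebra.toSubmodule (Algebra.adjoin ℂ s) ≤ P := by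
  rw [Algebra.adjoin_eq_span, Submodule.span_le]
  intro x hx
  induction hx using Submonoid.closure_induction_right with
  | one => exact h1
  | mul_right x _ y hy ih => exact hP x ih y hy

theorem list_prod_mul_le_mul_list_prod {ι : Type*} (N : ι → Submodule ℂ A) (G : Submodule ℂ A)
    (l : List ι) (h : ∀ i ∈ l, N i * G ≤ G * N i) :
    (l.map N).prod * G ≤ G * (l.map N).prod := by
  induction l with
  | nil => simp
  | cons i l ih =>
    simp only [List.map_cons, List.prod_cons]
    calc N i * (l.map N).prod * G = N i * ((l.map N).prod * G) := mul_assoc _ _ _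
      _ ≤ N i * (G * (l.map N).prod) := by
          exact mul_le_mul' le_rfl (ih fun i hi => h i (by simp [hi]))
      _ = N i * G * (l.map N).prod := (mul_assoc _ _ _).symm
      _ ≤ G * N i * (l.map N).prod := mul_le_mul' (h i (by simp)) le_rfl
      _ = G * (N i * (l.map N).prod) := mul_assoc _ _ _

/-- If a factor can be moved to the left through all later submodules of an ordered product and
is absorbed by its own submodule, then it is absorbed by the product. -/
theorem list_prod_mul_le {ι : Type*} [LinearOrder ι] (N G : ι → Submodule ℂ A) (l : List ι)
    (hl : l.Pairwise (· < ·)) (hlt : ∀ i j, j < i → N i * G j ≤ G j * N i)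
    (hself : ∀ j, N j * G j ≤ N j) (j : ι) (hj : j ∈ l) :
    (l.map N).prod * G j ≤ (l.map N).prod := by
  induction l with
  | nil => simp at hj
  | cons i l ih =>
    rw [List.pairwise_cons] at hl
    simp only [List.map_cons, List.prod_cons]
    rcases List.mem_cons.1 hj with rfl | hj
    · calc N j * (l.map N).prod * G j = N j * ((l.map N).prod * G j) := mul_assoc _ _ _
        _ ≤ N j * (G j * (l.map N).prod) := by
            refine mul_le_mul' le_rfl ?_
            exact list_prod_mul_le_mul_list_prod N _ l fun i hi => hlt i j (hl.1 i hi)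
        _ = N j * G j * (l.map N).prod := (mul_assoc _ _ _).symm
        _ ≤ N j * (l.map N).prod := mul_le_mul' (hself j) le_rfl
    · rw [mul_assoc]
      exact mul_le_mul' le_rfl (ih hl.2 hj)

theorem list_prod_map_le {ι : Type*} (N N' : ι → Submodule ℂ A) (h : ∀ i, N i ≤ N' i)
    (l : List ι) : (l.map N).prod ≤ (l.map N').prod := by
  induction l with
  | nil => simp
  | cons i l ih =>
    simp only [List.map_cons, List.prod_cons]
    exact mul_le_mul' (h i) ih

theorem list_prod_span_le {ι κ : Type*} [DecidableEq ι] [Inhabited κ] (f : ι → κ → A)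
    (l : List ι) (hl : l.Nodup) :
    (l.map fun i => Submodule.span ℂ (Set.range (f i))).prod ≤
      Submodule.span ℂ (Set.range fun a : ι → κ => (l.map fun i => f i (a i)).prod) := by
  induction l with
  | nil => simp [Submodule.one_eq_span]
  | cons i l ih =>
    rw [List.nodup_cons] at hl
    simp only [List.map_cons, List.prod_cons]
    refine (mul_le_mul_right (ih hl.2) _).trans ?_
    rw [Submodule.span_mul_span, Submodule.span_le]
    rintro _ ⟨_, ⟨k, rfl⟩, _, ⟨a, rfl⟩, rfl⟩
    refine Submodule.subset_span ⟨Function.update a i k, ?_⟩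
    simp only [Function.update_self]
    congr 2
    refine List.map_congr_left fun r hr => ?_
    rw [Function.update_of_ne]
    rintro rfl
    exact hl.1 hr

end Span

theorem gen_mul_gen_mem (hq : q ≠ 0) {t j : Fin n} (h : j < t) (s i : Fin n) :
    gen q s t * gen q i j ∈ Submodule.span ℂ (Set.range fun i => gen q i j) *
      Subalgebra.toSubmodule (Algebra.adjoin ℂ (Set.range fun i => gen q i t)) := by
  have hmem : ∀ i s, gen q i j * gen q s t ∈ Submodule.span ℂ (Set.range fun i => gen q i j) *
      Subalgebra.toSubmodule (Algebra.adjoin ℂ (Set.range fun i => gen q i t)) := fun i s =>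
    Submodule.mul_mem_mul (Submodule.subset_span ⟨i, rfl⟩) (Algebra.subset_adjoin ⟨s, rfl⟩)
  rcases lt_trichotomy s i with hs | rfl | hs
  · rw [gen_comm hs h]
    exact hmem _ _
  · have := gen_row (q := q) s h
    rw [eq_inv_smul_iff₀ hq] at this
    rw [← this]
    exact Submodule.smul_mem _ _ (hmem _ _)
  · have := gen_cross (q := q) hs h
    rw [eq_sub_iff_add_eq, gen_comm hs h] at this
    rw [← this]
    exact Submodule.add_mem _ (hmem _ _) (Submodule.smul_mem _ _ (hmem _ _))

/-- The subalgebra of column `t` can be moved to the right past the generators of an earlier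
column `j`. -/
theorem column_mul_le (hq : q ≠ 0) (t j : Fin n) (h : j < t) :
    Subalgebra.toSubmodule (Algebra.adjoin ℂ (Set.range fun i => gen q i t)) *
        Submodule.span ℂ (Set.range fun i => gen q i j) ≤
      Submodule.span ℂ (Set.range fun i => gen q i j) *
        Subalgebra.toSubmodule (Algebra.adjoin ℂ (Set.range fun i => gen q i t)) := by
  set G := Submodule.span ℂ (Set.range fun i => gen q i j)
  set C := Algebra.adjoin ℂ (Set.range fun i => gen q i t)
  rw [Submodule.mul_le]
  intro x hx
  induction hx using Algebra.adjoin_induction with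
  | mem x hx =>
    obtain ⟨s, rfl⟩ := hx
    intro g hg
    induction hg using Submodule.span_induction with
    | mem g hg =>
      obtain ⟨i, rfl⟩ := hg
      exact gen_mul_gen_mem hq h s i
    | zero => simp
    | add g g' _ _ ih ih' => rw [mul_add]; exact Submodule.add_mem _ ih ih'
    | smul r g _ ih => rw [mul_smul_comm]; exact Submodule.smul_mem _ _ ih
  | algebraMap r =>
    intro g hg
    rw [Algebra.commutes]
    exact Submodule.mul_mem_mul hg (C.algebraMap_mem r)
  | add x y _ _ ih ih' =>
    intro g hg
    rw [add_mul]
    exact Submodule.add_mem _ (ih g hg) (ih' g hg)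
  | mul x y _ _ ih ih' =>
    intro g hg
    rw [mul_assoc]
    refine Submodule.mul_induction_on (ih' g hg) (fun g' hg' c hc => ?_) fun u v hu hv => ?_
    · rw [← mul_assoc]
      refine Submodule.mul_induction_on (ih g' hg') (fun g'' hg'' c' hc' => ?_) fun u v hu hv => ?_
      · rw [mul_assoc]
        exact Submodule.mul_mem_mul hg'' (C.mul_mem hc' hc)
      · rw [add_mul]; exact Submodule.add_mem _ hu hv
    · rw [mul_add]; exact Submodule.add_mem _ hu hv

/-- Within a column the generators `q`-commute, so that its subalgebra is spanned by ordered
products of powers. -/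
theorem adjoin_column_le (hq : q ≠ 0) (j : Fin n) :
    Subalgebra.toSubmodule (Algebra.adjoin ℂ (Set.range fun i => gen q i j)) ≤
      ((List.finRange n).map fun i =>
        Submodule.span ℂ (Set.range fun k : ℕ => gen q i j ^ k)).prod := by
  have hpow : ∀ i, (1 : Alg n q) ∈ Submodule.span ℂ (Set.range fun k : ℕ => gen q i j ^ k) :=
    fun i => Submodule.subset_span ⟨0, pow_zero _⟩
  refine adjoin_le_of_mul_mem _ _ ?_ ?_
  · induction List.finRange n with
    | nil => exact Submodule.one_le.1 le_rfl
    | cons i l ih =>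
      rw [List.map_cons, List.prod_cons, ← mul_one (1 : Alg n q)]
      exact Submodule.mul_mem_mul (hpow i) ih
  · rintro x hx _ ⟨i, rfl⟩
    refine list_prod_mul_le _ (fun i => Submodule.span ℂ {gen q i j}) _
      (List.pairwise_lt_finRange n) ?_ ?_ i (List.mem_finRange i)
      (Submodule.mul_mem_mul hx (Submodule.mem_span_singleton_self _))
    · intro i k hki
      have hcol : gen q i j * gen q k j = q • (gen q k j * gen q i j) := by
        have := gen_col (q := q) j hki
        rw [eq_inv_smul_iff₀ hq] at this
        exact this.symm
      have hc : ∀ m : ℕ, gen q i j ^ m * gen q k j = q ^ m • (gen q k j * gen q i j ^ m) := by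
        intro m
        induction m with
        | zero => simp
        | succ m ih =>
          rw [pow_succ, mul_assoc, hcol, mul_smul_comm, ← mul_assoc, ih, smul_mul_assoc, smul_smul,
            mul_assoc, pow_succ, mul_comm q]
      rw [Submodule.span_mul_span, Submodule.span_le]
      rintro _ ⟨_, ⟨m, rfl⟩, _, rfl, rfl⟩
      simp only [SetLike.mem_coe]
      rw [hc]
      exact Submodule.smul_mem _ _ (Submodule.mul_mem_mul (Submodule.mem_span_singleton_self _)
        (Submodule.subset_span ⟨m, rfl⟩))
    · intro i
      rw [Submodule.span_mul_span, Submodule.span_le]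
      rintro _ ⟨_, ⟨m, rfl⟩, _, rfl, rfl⟩
      exact Submodule.subset_span ⟨m + 1, pow_succ _ _⟩

theorem adjoin_gen_eq_top :
    Algebra.adjoin ℂ (Set.range fun p : Fin n × Fin n => gen q p.1 p.2) = ⊤ := by
  have h : (Set.range fun p : Fin n × Fin n => gen q p.1 p.2) =
      RingQuot.mkAlgHom ℂ (Rel n q) '' Set.range (FreeAlgebra.ι ℂ) := by
    rw [← Set.range_comp]; rfl
  rw [h, ← AlgHom.map_adjoin, FreeAlgebra.adjoin_range_ι, Algebra.map_top,
    AlgHom.range_eq_top]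
  exact RingQuot.mkAlgHom_surjective ℂ _

theorem span_mono (hq : q ≠ 0) :
    Submodule.span ℂ (Set.range (mono q : Expo n → Alg n q)) = ⊤ := by
  set C := fun j : Fin n =>
    Subalgebra.toSubmodule (Algebra.adjoin ℂ (Set.range fun i => gen q i j))
  have htop : (⊤ : Submodule ℂ (Alg n q)) ≤ ((List.finRange n).map C).prod := by
    rw [← Algebra.top_toSubmodule, ← adjoin_gen_eq_top]
    refine adjoin_le_of_mul_mem _ _ ?_ ?_
    · induction List.finRange n with
      | nil => exact Submodule.one_le.1 le_rfl
      | cons i l ih =>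
        rw [List.map_cons, List.prod_cons, ← mul_one (1 : Alg n q)]
        exact Submodule.mul_mem_mul (Subalgebra.one_mem _) ih
    · rintro x hx _ ⟨⟨i, j⟩, rfl⟩
      refine list_prod_mul_le C (fun j => Submodule.span ℂ (Set.range fun i => gen q i j)) _
        (List.pairwise_lt_finRange n) (column_mul_le hq) ?_ j (List.mem_finRange j)
        (Submodule.mul_mem_mul hx (Submodule.subset_span ⟨i, rfl⟩))
      intro j
      rw [Submodule.mul_le]
      intro x hx g hg
      exact Subalgebra.mul_mem _ hx (Algebra.span_le_adjoin ℂ _ hg)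
  have hC : ∀ j, C j ≤ Submodule.span ℂ (Set.range fun c : Fin n → ℕ =>
      ((List.finRange n).map fun i => gen q i j ^ c i).prod) := fun j =>
    (adjoin_column_le hq j).trans
      (list_prod_span_le (fun i (k : ℕ) => gen q i j ^ k) _ (List.nodup_finRange n))
  refine top_le_iff.1 (htop.trans ?_)
  refine (list_prod_map_le _ _ hC _).trans ((list_prod_span_le (fun j (c : Fin n → ℕ) =>
    ((List.finRange n).map fun i => gen q i j ^ c i).prod) _ (List.nodup_finRange n)).trans ?_)
  refine Submodule.span_mono ?_
  rintro _ ⟨a, rfl⟩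
  exact ⟨fun i j => a j i, rfl⟩

/-- The ordered monomials form a basis, and right multiplication by a generator is given in this
basis by the element `mulGen` of the `q`-Weyl algebra. -/
theorem exists_basis_mono (hq : q ≠ 0) : ∃ b : Module.Basis (Expo n) ℂ (Alg n q),
    (∀ a, b a = mono q a) ∧ ∀ i j, rightMul q i j = (weylModel b hq).mulGen i j := by
  set Φ : FormalSpan n →ₗ[ℂ] Alg n q := (formalBasis n).constr ℂ (mono q)
  have hΦ : ∀ a, Φ (formalBasis n a) = mono q a := fun a => Module.Basis.constr_basis _ _ _ _
  have h1 : formalValue hq ∘ₗ Φ = LinearMap.id := (formalBasis n).ext fun a => by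
    simp [hΦ, formalValue_mono]
  have hsurj : Function.Surjective Φ := by
    rw [← LinearMap.range_eq_top, ← top_le_iff, ← span_mono hq, Submodule.span_le]
    rintro _ ⟨a, rfl⟩
    exact ⟨_, hΦ a⟩
  have h2 : Φ ∘ₗ formalValue hq = LinearMap.id := by
    ext z
    obtain ⟨u, rfl⟩ := hsurj z
    exact congrArg Φ (LinearMap.congr_fun h1 u)
  set e : FormalSpan n ≃ₗ[ℂ] Alg n q := LinearEquiv.ofLinearMap Φ (formalValue hq) h2 h1
  refine ⟨(formalBasis n).map e, fun a => hΦ a, fun i j => ?_⟩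
  rw [weylModel_map, QWeyl.mulGen, QWeyl.truncMul_map]
  ext z
  change z * gen q i j = Φ ((weylModel (formalBasis n) hq).mulGen i j (formalValue hq z))
  rw [← formalValue_mul_gen]
  exact (LinearMap.congr_fun h2 _).symm

end QuantumMatrix

namespace QuantumMatrix
namespace QWeyl

variable {n : ℕ} {q : ℂ} {B : Type*} [Ring B] [Algebra ℂ B]

/-! ### The leading term of right multiplication -/

/-- The nodes strictly below `p` in its column and strictly to the right of `p` in its row. -/
def hook (p : Fin n × Fin n) : Finset (Fin n × Fin n) :=
  Finset.univ.filter fun r => (r.2 = p.2 ∧ p.1 < r.1) ∨ (r.1 = p.1 ∧ p.2 < r.2)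

/-- The weight of the operator `V^SE` at the node `p`. -/
def hookWeight (p : Fin n × Fin n) : Fin n × Fin n → ℤ := ∑ r ∈ hook p, Pi.single r 1

/-- The weight which is `1` at the nodes of row `i` in the columns from `m` on. -/
def rightFrom (i : Fin n) (m : ℕ) : Fin n × Fin n → ℤ :=
  fun p => if p.1 = i ∧ m ≤ p.2.val then 1 else 0

theorem hookWeight_apply (p r : Fin n × Fin n) :
    hookWeight p r = if r ∈ hook p then 1 else 0 := by
  simp [hookWeight, Finset.sum_apply, Pi.single_apply]

theorem hookWeight_self (p : Fin n × Fin n) : hookWeight p p = 0 := by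
  simp [hookWeight_apply, hook]

theorem lt_of_mem_hook {p r : Fin n × Fin n} (h : r ∈ hook p) : p < r := by
  rw [hook, Finset.mem_filter] at h
  rcases h.2 with h | h
  · exact Prod.lt_iff.2 (Or.inl ⟨h.2, h.1.ge⟩)
  · exact Prod.lt_iff.2 (Or.inr ⟨h.1.ge, h.2⟩)

theorem hookWeight_eq (i j : Fin n) :
    hookWeight (i, j) = below i j + rightFrom i (j + 1) := by
  ext ⟨k, l⟩
  simp only [hookWeight_apply, hook, below, rightFrom, Pi.add_apply, Finset.mem_filter,
    Finset.mem_univ, true_and, Fin.lt_def, Fin.ext_iff]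
  split_ifs <;> omega

theorem rightFrom_eq (i t : Fin n) :
    rightFrom i t = rightFrom i (t + 1) + Pi.single (i, t) 1 := by
  ext ⟨k, l⟩
  simp only [rightFrom, Pi.add_apply, Pi.single_apply, Prod.mk.injEq, Fin.ext_iff]
  split_ifs <;> omega

theorem rightFrom_top (i : Fin n) : rightFrom i n = 0 := by
  ext ⟨k, l⟩
  simp [rightFrom]

variable (w : QWeyl (Fin n × Fin n) q B)

/-- The leading term `V^SE M` of right multiplication by the generator at the node `p`. -/
def lead (p : Fin n × Fin n) : B := w.M p * w.K (hookWeight p)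

/-- The lowering operator at the node `p` that enters the lower order terms of right
multiplication. -/
def lowerHook (p : Fin n × Fin n) : B := w.D p * w.K (-hookWeight p - Pi.single p 1)

/-- Right multiplication by `Z_ij` on the monomials in the first `m` columns, multiplied by the
factor that the columns from `m` on contribute to its leading term. -/
noncomputable def twistedMul (m : ℕ) (i j : Fin n) : B :=
  w.K (rightFrom i m) * w.truncMul m i j

variable {w}

theorem twistedMul_top (i j : Fin n) : w.twistedMul n i j = w.mulGen i j := by
  rw [twistedMul, rightFrom_top, w.K_zero, one_mul, mulGen]

theorem twistedMul_self (i j : Fin n) : w.twistedMul (j + 1) i j = w.lead (i, j) := by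
  rw [twistedMul, truncMul_self, colMul, w.K_mul_MK, mul_assoc, ← w.K_add, ← hookWeight_eq,
    lead]
  simp [rightFrom]

/-- Passing column `t` adds to the twisted right multiplication only terms at nodes that lie
weakly south-east of `(i, j)` and differ from it. -/
theorem twistedMul_succ {t j : Fin n} (i : Fin n) (h : j < t) :
    w.twistedMul (t + 1) i j = w.twistedMul t i j +
      ∑ s, if i < s then
        (q - q⁻¹) • (w.lead (i, t) * w.lowerHook (s, t) * w.twistedMul t s j) else 0 := by
  have hterm : ∀ s, w.K (rightFrom i (t + 1)) * (w.colTransfer t i s * w.truncMul t s j) =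
      (if i = s then w.twistedMul t i j else 0) + if i < s then
        (q - q⁻¹) • (w.lead (i, t) * w.lowerHook (s, t) * w.twistedMul t s j) else 0 := by
    intro s
    rcases lt_trichotomy i s with hs | rfl | hs
    · rw [if_neg hs.ne, if_pos hs, zero_add, colTransfer_lt hs, smul_mul_assoc, mul_smul_comm]
      congr 1
      have e1 : w.K (rightFrom i (t + 1)) * w.colMul t i = w.lead (i, t) := by
        rw [← twistedMul_self, twistedMul, truncMul_self]
      have e2 : w.colLower t s = w.lowerHook (s, t) * w.K (rightFrom s t) := by
        rw [lowerHook, mul_assoc, ← w.K_add, colLower, hookWeight_eq, rightFrom_eq]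
        congr 2
        abel
      rw [← mul_assoc, ← mul_assoc, e1, e2, twistedMul]
      simp only [mul_assoc]
    · rw [if_pos rfl, if_neg (lt_irrefl _), add_zero, colTransfer_self, ← mul_assoc, ← w.K_add,
        ← rightFrom_eq, twistedMul]
    · simp [hs.ne', hs.not_gt, colTransfer_gt hs]
  rw [twistedMul, truncMul_of_lt i h, Finset.mul_sum]
  simp only [hterm, Finset.sum_add_distrib, Finset.sum_ite_eq, Finset.mem_univ, if_true]

theorem twistedMul_mem (S : Subalgebra ℂ B) (j : Fin n) (m : ℕ) (hm : m ≤ n) (i : Fin n)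
    (h : ∀ r : Fin n × Fin n, (i, j) ≤ r → w.lead r ∈ S ∧ w.lowerHook r ∈ S) :
    w.twistedMul m i j ∈ S := by
  induction m generalizing i with
  | zero => simp [twistedMul, truncMul]
  | succ m ih =>
    obtain ⟨t, rfl⟩ : ∃ t : Fin n, t.val = m := ⟨⟨m, hm⟩, rfl⟩
    rcases lt_trichotomy j t with hj | rfl | hj
    · rw [twistedMul_succ i hj]
      refine S.add_mem (ih t.isLt.le i h) (S.sum_mem fun s _ => ?_)
      split_ifs with hs
      · refine S.smul_mem (S.mul_mem (S.mul_mem (h _ (Prod.mk_le_mk.2 ⟨le_rfl, hj.le⟩)).1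
          (h _ (Prod.mk_le_mk.2 ⟨hs.le, hj.le⟩)).2)
          (ih t.isLt.le s fun r hr => h r (le_trans (Prod.mk_le_mk.2 ⟨hs.le, le_rfl⟩) hr))) _
      · exact S.zero_mem
    · rw [twistedMul_self]
      exact (h _ le_rfl).1
    · rw [twistedMul, truncMul_of_gt i hj, mul_zero]
      exact S.zero_mem

/-- Right multiplication by the generator at `p` is its leading term up to operators at nodes
that lie weakly south-east of `p` and differ from it. -/
theorem mulGen_sub_lead_mem (S : Subalgebra ℂ B) (p : Fin n × Fin n)
    (h : ∀ r, p < r → w.lead r ∈ S ∧ w.lowerHook r ∈ S) :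
    w.mulGen p.1 p.2 - w.lead p ∈ S := by
  obtain ⟨i, j⟩ := p
  have key : ∀ m, j.val + 1 ≤ m → m ≤ n → w.twistedMul m i j - w.lead (i, j) ∈ S := by
    intro m hm
    induction m, hm using Nat.le_induction with
    | base => intro _; rw [twistedMul_self, sub_self]; exact S.zero_mem
    | succ m hm ih =>
      intro hmn
      obtain ⟨t, rfl⟩ : ∃ t : Fin n, t.val = m := ⟨⟨m, hmn⟩, rfl⟩
      have hj : j < t := hm
      rw [twistedMul_succ i hj, add_sub_right_comm]
      refine S.add_mem (ih t.isLt.le) (S.sum_mem fun s _ => ?_)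
      split_ifs with hs
      · have hsj : (i, j) < (s, j) := Prod.mk_lt_mk_iff_left.2 hs
        refine S.smul_mem (S.mul_mem (S.mul_mem (h _ (Prod.mk_lt_mk_iff_right.2 hj)).1
          (h _ (hsj.trans_le (Prod.mk_le_mk.2 ⟨le_rfl, hj.le⟩))).2)
          (twistedMul_mem S j t t.isLt.le s fun r hr => h r (hsj.trans_le hr))) _
      · exact S.zero_mem
  rw [← twistedMul_top]
  exact key n j.isLt le_rfl

/-! ### Torus elements generated by raising and lowering operators -/

theorem K_hookWeight_mul_M (p : Fin n × Fin n) :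
    w.K (hookWeight p) * w.M p = w.M p * w.K (hookWeight p) := by
  rw [w.K_M, hookWeight_self, zpow_zero, one_smul]

theorem K_hookWeight_mul_D (p : Fin n × Fin n) :
    w.K (hookWeight p) * w.D p = w.D p * w.K (hookWeight p) := by
  rw [w.K_D, hookWeight_self, neg_zero, zpow_zero, one_smul]

theorem K_smul_sum_mem (S : Subalgebra ℂ B) (m : ℤ) (U : Finset (Fin n × Fin n))
    (h : ∀ r ∈ U, w.K (m • Pi.single r 1) ∈ S) :
    w.K (m • ∑ r ∈ U, Pi.single r 1) ∈ S := by
  rw [Finset.smul_sum]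
  exact w.K_sum_mem S U _ h

theorem K_single_eq (hc : q - q⁻¹ ≠ 0) (p : Fin n × Fin n) :
    w.K (Pi.single p 1) = w.D p * w.M p - q⁻¹ • (w.M p * w.D p) := by
  refine smul_right_injective B hc ?_
  simp only [smul_sub, smul_comm (q - q⁻¹) q⁻¹, w.DM, w.MD]
  module

theorem K_neg_single_eq (hc : q - q⁻¹ ≠ 0) (p : Fin n × Fin n) :
    w.K (-Pi.single p 1) = w.D p * w.M p - q • (w.M p * w.D p) := by
  refine smul_right_injective B hc ?_
  simp only [smul_sub, smul_comm (q - q⁻¹) q, w.DM, w.MD]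
  module

theorem K_single_mem (hc : q - q⁻¹ ≠ 0) (S : Subalgebra ℂ B) {p : Fin n × Fin n}
    (hM : w.M p ∈ S) (hD : w.D p ∈ S) : w.K (Pi.single p 1) ∈ S := by
  rw [K_single_eq hc]
  exact S.sub_mem (S.mul_mem hD hM) (S.smul_mem (S.mul_mem hM hD) _)

theorem lead_mem_of_weyl_mem (hc : q - q⁻¹ ≠ 0) (S : Subalgebra ℂ B)
    (hM : ∀ p, w.M p ∈ S) (hD : ∀ p, w.D p ∈ S) (p : Fin n × Fin n) :
    w.lead p ∈ S ∧ w.K (hookWeight p) * w.D p ∈ S := by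
  have hK : w.K (hookWeight p) ∈ S :=
    w.K_sum_mem S _ _ fun r _ => K_single_mem hc S (hM r) (hD r)
  exact ⟨S.mul_mem (hM p) hK, S.mul_mem hK (hD p)⟩

/-- A subalgebra that contains `V^SE M` and `V^SE D` at all nodes weakly south-east of `p`
contains the whole `q`-Weyl algebra at the node `p`. -/
theorem weyl_mem_of_lead_mem (hc : q - q⁻¹ ≠ 0) (S : Subalgebra ℂ B) (p : Fin n × Fin n)
    (h : ∀ r, p ≤ r → w.lead r ∈ S ∧ w.K (hookWeight r) * w.D r ∈ S) :
    w.M p ∈ S ∧ w.D p ∈ S ∧ w.K (Pi.single p 1) ∈ S ∧ w.K (-Pi.single p 1) ∈ S := by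
  induction p using WellFoundedGT.induction with
  | ind p ih =>
    have hV : w.K (-hookWeight p) ∈ S := by
      rw [← neg_one_zsmul]
      refine K_smul_sum_mem S _ _ fun r hr => ?_
      rw [neg_one_zsmul]
      have hpr := lt_of_mem_hook hr
      exact (ih r hpr fun r' hr' => h r' (hpr.le.trans hr')).2.2.2
    have hM : w.M p ∈ S := by
      have := S.mul_mem (h p le_rfl).1 hV
      rwa [lead, mul_assoc, w.K_mul_K_neg, mul_one] at this
    have hD : w.D p ∈ S := by
      have := S.mul_mem hV (h p le_rfl).2
      rwa [← mul_assoc, w.K_neg_mul_K, one_mul] at this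
    refine ⟨hM, hD, K_single_mem hc S hM hD, ?_⟩
    rw [K_neg_single_eq hc]
    exact S.sub_mem (S.mul_mem hD hM) (S.smul_mem (S.mul_mem hM hD) _)

theorem lowerHook_mem_of_lead_mem (hc : q - q⁻¹ ≠ 0) (S : Subalgebra ℂ B) (p : Fin n × Fin n)
    (h : ∀ r, p ≤ r → w.lead r ∈ S ∧ w.K (hookWeight r) * w.D r ∈ S) :
    w.lowerHook p ∈ S := by
  have hp := weyl_mem_of_lead_mem hc S p h
  rw [lowerHook, sub_eq_add_neg, w.K_add]
  refine S.mul_mem hp.2.1 (S.mul_mem ?_ hp.2.2.2)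
  rw [← neg_one_zsmul]
  refine K_smul_sum_mem S _ _ fun r hr => ?_
  rw [neg_one_zsmul]
  have hpr := lt_of_mem_hook hr
  exact (weyl_mem_of_lead_mem hc S r fun r' hr' => h r' (hpr.le.trans hr')).2.2.2

variable (w)

/-- The operator `V^SE 𝒟` at the node `p`, where `𝒟 = H⁻¹ D`. -/
def leadLower (p : Fin n × Fin n) : B :=
  w.K (hookWeight p) * (w.K (-Pi.single p 1) * w.D p)

variable {w}

theorem leadLower_eq (p : Fin n × Fin n) :
    w.leadLower p = q • (w.D p * w.K (hookWeight p - Pi.single p 1)) := by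
  rw [leadLower, w.K_D, mul_smul_comm, ← mul_assoc, K_hookWeight_mul_D, mul_assoc, ← w.K_add,
    sub_eq_add_neg]
  simp

theorem smul_leadLower_mul_lead (p : Fin n × Fin n) :
    (q - q⁻¹) • (w.leadLower p * w.lead p) =
      q • w.K ((2 : ℤ) • hookWeight p) -
        q⁻¹ • w.K ((2 : ℤ) • hookWeight p - (2 : ℤ) • Pi.single p 1) := by
  have e : w.leadLower p * w.lead p =
      w.K (hookWeight p + -Pi.single p 1) * (w.D p * w.M p) * w.K (hookWeight p) := by
    rw [leadLower, lead, w.K_add]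
    simp only [mul_assoc]
  rw [e, ← smul_mul_assoc, ← mul_smul_comm, w.DM]
  simp only [mul_sub, sub_mul, mul_smul_comm, smul_mul_assoc, ← w.K_add]
  congr 3 <;> abel_nf

theorem smul_lead_mul_leadLower (p : Fin n × Fin n) :
    (q - q⁻¹) • (w.lead p * w.leadLower p) =
      q • (w.K ((2 : ℤ) • hookWeight p) -
        w.K ((2 : ℤ) • hookWeight p - (2 : ℤ) • Pi.single p 1)) := by
  have e : w.lead p * w.leadLower p =
      q • ((w.M p * w.D p) * w.K ((2 : ℤ) • hookWeight p - Pi.single p 1)) := by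
    have h : w.K (hookWeight p) * w.D p = (1 : ℂ) • (w.D p * w.K (hookWeight p)) := by
      rw [one_smul, K_hookWeight_mul_D]
    rw [leadLower_eq, lead, mul_smul_comm, mul_mul_mul_of_swap h, ← w.K_add, one_smul]
    congr 3
    abel
  rw [e, smul_comm, ← smul_mul_assoc, w.MD]
  simp only [sub_mul, ← w.K_add]
  congr 3 <;> abel_nf

theorem leadLower_mul_lead_sub (hc : q - q⁻¹ ≠ 0) (p : Fin n × Fin n) :
    w.leadLower p * w.lead p - w.lead p * w.leadLower p =
      w.K ((2 : ℤ) • hookWeight p - (2 : ℤ) • Pi.single p 1) := by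
  refine smul_right_injective B hc ?_
  simp only [smul_sub, smul_leadLower_mul_lead, smul_lead_mul_leadLower]
  module

theorem leadLower_mul_lead_sub_smul (hq : q ≠ 0) (hc : q - q⁻¹ ≠ 0) (p : Fin n × Fin n) :
    w.leadLower p * w.lead p - (q⁻¹ * q⁻¹) • (w.lead p * w.leadLower p) =
      w.K ((2 : ℤ) • hookWeight p) := by
  refine smul_right_injective B hc ?_
  simp only [smul_sub, smul_comm (q - q⁻¹) (q⁻¹ * q⁻¹), smul_leadLower_mul_lead,
    smul_lead_mul_leadLower]
  match_scalars <;> field_simp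
  ring

/-- A subalgebra that contains `V^SE M` and `V^SE 𝒟` at all nodes weakly south-east of `p`
contains `H⁻²` at `p`. -/
theorem K_neg_two_mem (hc : q - q⁻¹ ≠ 0) (S : Subalgebra ℂ B) (p : Fin n × Fin n)
    (h : ∀ r, p ≤ r → w.lead r ∈ S ∧ w.leadLower r ∈ S) :
    w.K ((-2 : ℤ) • Pi.single p 1) ∈ S := by
  induction p using WellFoundedGT.induction with
  | ind p ih =>
    have hV : w.K ((-2 : ℤ) • hookWeight p) ∈ S := K_smul_sum_mem S _ _ fun r hr =>
      ih r (lt_of_mem_hook hr) fun r' hr' => h r' ((lt_of_mem_hook hr).le.trans hr')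
    obtain ⟨hA, hB⟩ := h p le_rfl
    have h1 := S.mul_mem hV (leadLower_mul_lead_sub (w := w) hc p ▸
      S.sub_mem (S.mul_mem hB hA) (S.mul_mem hA hB))
    rw [← w.K_add] at h1
    convert h1 using 2
    module

theorem lowerHook_mem_of_leadLower_mem (hq : q ≠ 0) (hc : q - q⁻¹ ≠ 0) (S : Subalgebra ℂ B)
    (p : Fin n × Fin n) (h : ∀ r, p ≤ r → w.lead r ∈ S ∧ w.leadLower r ∈ S) :
    w.lowerHook p ∈ S := by
  have hV : w.K ((-2 : ℤ) • hookWeight p) ∈ S := K_smul_sum_mem S _ _ fun r hr =>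
    K_neg_two_mem hc S r fun r' hr' => h r' ((lt_of_mem_hook hr).le.trans hr')
  have h1 := S.smul_mem (S.mul_mem (h p le_rfl).2 hV) q⁻¹
  rw [leadLower_eq, smul_mul_assoc, smul_smul, inv_mul_cancel₀ hq, one_smul, mul_assoc,
    ← w.K_add] at h1
  rw [lowerHook]
  convert h1 using 3
  module

/-- At a node that lies in a hook, `H²` is the product of the square of `V^SE` at the corner of
the hook and of `H⁻²` at the other nodes of the hook. -/
theorem K_two_mem (hq : q ≠ 0) (hc : q - q⁻¹ ≠ 0) (S : Subalgebra ℂ B)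
    (h : ∀ r, w.lead r ∈ S ∧ w.leadLower r ∈ S) {p r : Fin n × Fin n} (hr : r ∈ hook p) :
    w.K ((2 : ℤ) • Pi.single r 1) ∈ S := by
  have h1 : w.K ((2 : ℤ) • hookWeight p) ∈ S := by
    rw [← leadLower_mul_lead_sub_smul hq hc]
    exact S.sub_mem (S.mul_mem (h p).2 (h p).1) (S.smul_mem (S.mul_mem (h p).1 (h p).2) _)
  have h2 := K_smul_sum_mem (w := w) S (-2) ((hook p).erase r) fun r _ =>
    K_neg_two_mem hc S r fun r' _ => h r'
  have h3 := S.mul_mem h1 h2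
  rw [← w.K_add, hookWeight, ← Finset.add_sum_erase _ _ hr] at h3
  convert h3 using 2
  module

end QWeyl
end QuantumMatrix

namespace QuantumMatrix

variable {n : ℕ} {q : ℂ}

/-! ### Duality -/

section Dual

variable {β : Alg n q →ₗ[ℂ] Alg n q →ₗ[ℂ] ℂ} {T S T' S' : Module.End ℂ (Alg n q)}

theorem IsDual.add (h : IsDual β T S) (h' : IsDual β T' S') : IsDual β (T + T') (S + S') := by
  intro u w
  simp [h u w, h' u w]

theorem IsDual.smul (h : IsDual β T S) (r : ℂ) : IsDual β (r • T) (r • S) := by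
  intro u w
  simp [h u w]

theorem IsDual.mul (h : IsDual β T S) (h' : IsDual β T' S') : IsDual β (T * T') (S' * S) := by
  intro u w
  simp only [Module.End.mul_apply]
  rw [h' (S u) w, h u (T' w)]

theorem IsDual.algebraMap (r : ℂ) :
    IsDual β (algebraMap ℂ _ r) (algebraMap ℂ _ r) := by
  intro u w
  simp [Module.algebraMap_end_apply]

theorem IsDual.symm (hβ : ∀ u w, β u w = β w u) (h : IsDual β T S) : IsDual β S T := by
  intro u w
  rw [hβ, ← h w u, hβ]

theorem IsDual.unique (hβ : ∀ u, (∀ w, β u w = 0) → u = 0) (h : IsDual β T S)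
    (h' : IsDual β T S') : S = S' := by
  ext u
  rw [← sub_eq_zero]
  refine hβ _ fun w => ?_
  rw [map_sub, LinearMap.sub_apply, h u w, h' u w, sub_self]

theorem IsDual.of_basis (b : Module.Basis (Expo n) ℂ (Alg n q))
    (h : ∀ a c, β (S (b a)) (b c) = β (b a) (T (b c))) : IsDual β T S := by
  have e : β ∘ₗ S = (LinearMap.lcomp ℂ ℂ T) ∘ₗ β := b.ext fun a => b.ext fun c => h a c
  intro u w
  exact LinearMap.congr_fun (LinearMap.congr_fun e u) w

/-- A subalgebra generated by operators with duals in it is closed under duality. -/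
theorem exists_isDual_mem (s : Set (Module.End ℂ (Alg n q)))
    (h : ∀ T ∈ s, ∃ S ∈ Algebra.adjoin ℂ s, IsDual β T S) (hT : T ∈ Algebra.adjoin ℂ s) :
    ∃ S ∈ Algebra.adjoin ℂ s, IsDual β T S := by
  induction hT using Algebra.adjoin_induction with
  | mem x hx => exact h x hx
  | algebraMap r => exact ⟨_, Subalgebra.algebraMap_mem _ r, IsDual.algebraMap r⟩
  | add x y _ _ hx hy =>
    obtain ⟨S, hS, h⟩ := hx
    obtain ⟨S', hS', h'⟩ := hy
    exact ⟨_, add_mem hS hS', h.add h'⟩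
  | mul x y _ _ hx hy =>
    obtain ⟨S, hS, h⟩ := hx
    obtain ⟨S', hS', h'⟩ := hy
    exact ⟨_, mul_mem hS' hS, h.mul h'⟩

end Dual

section Pairing

variable (b : Module.Basis (Expo n) ℂ (Alg n q)) (ν : ℕ → ℂ)

/-- The diagonal entries of the pairing. -/
noncomputable def pairingDiag (q : ℂ) (ν : ℕ → ℂ) (a : Expo n) : ℂ :=
  (-1 / (q - q⁻¹)) ^ (∑ i, ∑ j, a i j) * ∏ i, ∏ j, qfact ν (a i j)

theorem pairing_basis (a c : Expo n) :
    pairing b ν (b a) (b c) = if a = c then pairingDiag q ν a else 0 := by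
  simp only [pairing, pairingDiag, Module.Basis.constr_basis, LinearMap.smul_apply,
    Module.Basis.coord_apply, Module.Basis.repr_self, Finsupp.single_apply, smul_eq_mul, eq_comm]
  split_ifs <;> simp

theorem pairingDiag_add_unitExpo (a : Expo n) (i j : Fin n) :
    pairingDiag q ν (a + unitExpo i j) = -1 / (q - q⁻¹) * ν (a i j + 1) * pairingDiag q ν a := by
  have h1 : ∑ k, ∑ l, (a + unitExpo i j) k l = ∑ k, ∑ l, a k l + 1 := by
    have : ∑ k, ∑ l, unitExpo i j k l = 1 := by
      rw [Finset.sum_eq_single i, Finset.sum_eq_single j]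
      · simp
      · intro l _ hl; simp [unitExpo_apply, hl.symm]
      · simp
      · intro k _ hk; simp [unitExpo_apply, hk.symm]
      · simp
    simp only [Pi.add_apply, Finset.sum_add_distrib, this]
  have h2 : ∏ k, ∏ l, qfact ν ((a + unitExpo i j) k l) =
      ν (a i j + 1) * ∏ k, ∏ l, qfact ν (a k l) := by
    have : ∀ k l, qfact ν ((a + unitExpo i j) k l) =
        (if k = i then if l = j then ν (a i j + 1) else 1 else 1) * qfact ν (a k l) := by
      intro k l
      by_cases h : (i, j) = (k, l)
      · obtain ⟨rfl, rfl⟩ := Prod.mk.inj h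
        simp [qfact, Finset.prod_range_succ, mul_comm]
      · have h' : ¬ (k = i ∧ l = j) := fun h' => h (by simp [h'.1, h'.2])
        rw [Pi.add_apply, Pi.add_apply, unitExpo_of_ne h, add_zero, ← ite_and, if_neg h', one_mul]
    simp only [this, Finset.prod_mul_distrib]
    congr 1
    rw [Finset.prod_eq_single i, Finset.prod_eq_single j]
    · simp
    · intro l _ hl; simp [hl]
    · simp
    · intro k _ hk; simp [hk]
    · simp
  rw [pairingDiag, h1, h2, pairingDiag, pow_succ]
  ring

theorem pairing_symm (u w : Alg n q) : pairing b ν u w = pairing b ν w u := by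
  have e : pairing b ν = (pairing b ν).flip := b.ext fun a => b.ext fun c => by
    rw [LinearMap.flip_apply, pairing_basis, pairing_basis]
    by_cases h : a = c
    · rw [h]
    · rw [if_neg h, if_neg (Ne.symm h)]
  exact LinearMap.congr_fun (LinearMap.congr_fun e u) w

theorem pairing_nondegenerate (hc : q - q⁻¹ ≠ 0) (hν : ∀ k, ν (k + 1) ≠ 0) (u : Alg n q)
    (h : ∀ w, pairing b ν u w = 0) : u = 0 := by
  refine b.repr.map_eq_zero_iff.1 (Finsupp.ext fun c => ?_)
  have h1 : pairing b ν u (b c) = b.repr u c * pairingDiag q ν c := by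
    have e : (pairing b ν).flip (b c) = pairingDiag q ν c • b.coord c := b.ext fun a => by
      simp only [LinearMap.flip_apply, pairing_basis, LinearMap.smul_apply,
        Module.Basis.coord_apply, Module.Basis.repr_self, Finsupp.single_apply, smul_eq_mul]
      split_ifs with h
      · rw [h, mul_one]
      · rw [mul_zero]
    rw [← LinearMap.flip_apply, e]
    simp [mul_comm]
  have h2 : pairingDiag q ν c ≠ 0 := by
    refine mul_ne_zero (pow_ne_zero _ (div_ne_zero (by simp) hc)) ?_
    exact Finset.prod_ne_zero_iff.2 fun i _ => Finset.prod_ne_zero_iff.2 fun j _ =>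
      Finset.prod_ne_zero_iff.2 fun k _ => hν k
  rw [h] at h1
  simpa using (mul_eq_zero.1 h1.symm).resolve_right h2

theorem isDual_torus (x : Fin n × Fin n → ℤ) :
    IsDual (pairing b ν) (torus b q x) (torus b q x) := by
  refine IsDual.of_basis b fun a c => ?_
  simp only [torus_basis, map_smul, LinearMap.smul_apply, pairing_basis, smul_eq_mul]
  split_ifs with h
  · rw [h]
  · simp

theorem isDual_raise (hν : ν 0 = 0) (p : Fin n × Fin n) :
    IsDual (pairing b ν) (raise b p) ((-1 / (q - q⁻¹)) • lower b ν p) := by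
  refine IsDual.of_basis b fun a c => ?_
  simp only [raise_basis, lower_basis, LinearMap.smul_apply, map_smul, pairing_basis, smul_eq_mul]
  by_cases h : a p.1 p.2 = 0
  · have : a ≠ c + unitExpo p.1 p.2 := by
      rintro rfl
      simp at h
    simp [h, hν, this]
  · obtain ⟨d, rfl⟩ := exists_eq_add_unitExpo h
    rw [add_unitExpo_sub]
    simp only [add_left_inj, pairingDiag_add_unitExpo, Pi.add_apply, unitExpo_self]
    split_ifs
    · ring
    · simp

/-! ### The algebra of quantized differential operators -/

/-- The operator `V^SE D^ν` at the node `p`, a multiple of the dual of `V^SE M`. -/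
noncomputable def dualLead (hq : q ≠ 0) (p : Fin n × Fin n) : Module.End ℂ (Alg n q) :=
  (weylModel b hq).K (QWeyl.hookWeight p) * lower b ν p

theorem isDual_lead (hq : q ≠ 0) (hν : ν 0 = 0) (p : Fin n × Fin n) :
    IsDual (pairing b ν) ((weylModel b hq).lead p) ((-1 / (q - q⁻¹)) • dualLead b ν hq p) := by
  rw [dualLead, ← mul_smul_comm]
  exact (isDual_raise b ν hν p).mul (isDual_torus b ν _)

theorem isDual_dualLead (hq : q ≠ 0) (hc : q - q⁻¹ ≠ 0) (hν : ν 0 = 0) (p : Fin n × Fin n) :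
    IsDual (pairing b ν) (dualLead b ν hq p) ((-1 / (q - q⁻¹))⁻¹ • (weylModel b hq).lead p) := by
  have h := ((isDual_lead b ν hq hν p).symm (pairing_symm b ν)).smul (-1 / (q - q⁻¹))⁻¹
  rwa [inv_smul_smul₀ (div_ne_zero (by simp) hc)] at h

/-- The algebra generated by the leading terms and their duals at the nodes in `U`. -/
noncomputable def leadAlg (hq : q ≠ 0) (U : Set (Fin n × Fin n)) :
    Subalgebra ℂ (Module.End ℂ (Alg n q)) :=
  Algebra.adjoin ℂ ((weylModel b hq).lead '' U ∪ dualLead b ν hq '' U)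

variable {b ν}

theorem lead_mem_leadAlg (hq : q ≠ 0) {U : Set (Fin n × Fin n)} {p : Fin n × Fin n} (hp : p ∈ U) :
    (weylModel b hq).lead p ∈ leadAlg b ν hq U :=
  Algebra.subset_adjoin (Or.inl ⟨p, hp, rfl⟩)

theorem dualLead_mem_leadAlg (hq : q ≠ 0) {U : Set (Fin n × Fin n)} {p : Fin n × Fin n}
    (hp : p ∈ U) : dualLead b ν hq p ∈ leadAlg b ν hq U :=
  Algebra.subset_adjoin (Or.inr ⟨p, hp, rfl⟩)

theorem exists_isDual_mem_leadAlg (hq : q ≠ 0) (hc : q - q⁻¹ ≠ 0) (hν : ν 0 = 0)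
    {U : Set (Fin n × Fin n)} {T : Module.End ℂ (Alg n q)} (hT : T ∈ leadAlg b ν hq U) :
    ∃ S ∈ leadAlg b ν hq U, IsDual (pairing b ν) T S := by
  refine exists_isDual_mem _ ?_ hT
  rintro _ (⟨p, hp, rfl⟩ | ⟨p, hp, rfl⟩)
  · exact ⟨_, Subalgebra.smul_mem _ (dualLead_mem_leadAlg hq hp) _, isDual_lead b ν hq hν p⟩
  · exact ⟨_, Subalgebra.smul_mem _ (lead_mem_leadAlg hq hp) _, isDual_dualLead b ν hq hc hν p⟩

/-- The lower order terms of right multiplication can be expressed through leading terms and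
their duals at the nodes that occur in them. -/
def LowerTermsGenerated (b : Module.Basis (Expo n) ℂ (Alg n q)) (ν : ℕ → ℂ) (hq : q ≠ 0) : Prop :=
  ∀ (S : Subalgebra ℂ (Module.End ℂ (Alg n q))) (p : Fin n × Fin n),
    (∀ r, p ≤ r → (weylModel b hq).lead r ∈ S ∧ dualLead b ν hq r ∈ S) →
      (weylModel b hq).lowerHook p ∈ S

theorem rightMul_sub_lead_mem (hq : q ≠ 0)
    (hb : ∀ i j, rightMul q i j = (weylModel b hq).mulGen i j) (hQ : LowerTermsGenerated b ν hq)
    (p : Fin n × Fin n) :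
    rightMul q p.1 p.2 - (weylModel b hq).lead p ∈ leadAlg b ν hq {r | p < r} := by
  rw [hb]
  refine QWeyl.mulGen_sub_lead_mem (w := weylModel b hq) (leadAlg b ν hq {r | p < r}) p
    fun r hr => ⟨lead_mem_leadAlg hq hr, ?_⟩
  exact hQ _ r fun r' hr' => ⟨lead_mem_leadAlg hq (hr.trans_le hr'),
    dualLead_mem_leadAlg hq (hr.trans_le hr')⟩

/-- This is `sub_add_cancel`, which does not unify here because the negation of `Alg n q` is reached
along two instance paths. -/
theorem end_sub_add_cancel (T S : Module.End ℂ (Alg n q)) : T - S + S = T :=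
  LinearMap.ext fun u => by simp

theorem end_mem_of_add_mem {A : Subalgebra ℂ (Module.End ℂ (Alg n q))}
    {T S : Module.End ℂ (Alg n q)} (hT : T ∈ A) (h : T + S ∈ A) : S ∈ A := by
  have h' := A.add_mem h (A.smul_mem hT (-1))
  convert h' using 1
  exact LinearMap.ext fun u => by simp

theorem leadAlg_mono (hq : q ≠ 0) {U U' : Set (Fin n × Fin n)} (h : U ⊆ U') :
    leadAlg b ν hq U ≤ leadAlg b ν hq U' :=
  Algebra.adjoin_mono (Set.union_subset_union (Set.image_mono h) (Set.image_mono h))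

theorem rightMul_mem_leadAlg (hq : q ≠ 0)
    (hb : ∀ i j, rightMul q i j = (weylModel b hq).mulGen i j) (hQ : LowerTermsGenerated b ν hq)
    (i j : Fin n) : rightMul q i j ∈ leadAlg b ν hq Set.univ := by
  have h := leadAlg_mono hq (Set.subset_univ _) (rightMul_sub_lead_mem hq hb hQ (i, j))
  have h' := add_mem h (lead_mem_leadAlg (b := b) (ν := ν) hq (Set.mem_univ (i, j)))
  rwa [end_sub_add_cancel] at h'

theorem existsUnique_isDual_rightMul (hq : q ≠ 0) (hc : q - q⁻¹ ≠ 0) (hν : ν 0 = 0)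
    (hν' : ∀ k, ν (k + 1) ≠ 0) (hb : ∀ i j, rightMul q i j = (weylModel b hq).mulGen i j)
    (hQ : LowerTermsGenerated b ν hq) (i j : Fin n) :
    ∃! S, IsDual (pairing b ν) (rightMul q i j) S := by
  obtain ⟨S, -, hS⟩ := exists_isDual_mem_leadAlg hq hc hν (rightMul_mem_leadAlg hq hb hQ i j)
  exact ⟨S, hS, fun S' hS' => hS'.unique (pairing_nondegenerate b ν hc hν') hS⟩

/-- The algebra generated by the right multiplications and their duals is generated by the
leading terms and their duals. Starting at the south-east corner, the lower order terms of a right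
multiplication and the duals of these terms are already known to lie in it. -/
theorem diffAlg_eq_leadAlg (hq : q ≠ 0) (hc : q - q⁻¹ ≠ 0) (hν : ν 0 = 0)
    (hν' : ∀ k, ν (k + 1) ≠ 0) (hb : ∀ i j, rightMul q i j = (weylModel b hq).mulGen i j)
    (hQ : LowerTermsGenerated b ν hq) : diffAlg b ν = leadAlg b ν hq Set.univ := by
  apply le_antisymm
  · refine Algebra.adjoin_le ?_
    rintro T (⟨i, j, hT⟩ | ⟨i, j, rfl⟩)
    · obtain ⟨S, hS, hS'⟩ :=
        exists_isDual_mem_leadAlg hq hc hν (rightMul_mem_leadAlg hq hb hQ i j)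
      rw [hT.unique (pairing_nondegenerate b ν hc hν') hS']
      exact hS
    · exact rightMul_mem_leadAlg hq hb hQ i j
  · have key : ∀ p, (weylModel b hq).lead p ∈ diffAlg b ν ∧ dualLead b ν hq p ∈ diffAlg b ν := by
      intro p
      induction p using WellFoundedGT.induction with
      | ind p ih =>
        have hle : leadAlg b ν hq {r | p < r} ≤ diffAlg b ν := by
          refine Algebra.adjoin_le ?_
          rintro _ (⟨r, hr, rfl⟩ | ⟨r, hr, rfl⟩)
          exacts [(ih r hr).1, (ih r hr).2]
        have hT := rightMul_sub_lead_mem hq hb hQ p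
        obtain ⟨S, hS, hd⟩ := exists_isDual_mem_leadAlg hq hc hν hT
        have hR : rightMul q p.1 p.2 ∈ diffAlg b ν := Algebra.subset_adjoin (Or.inr ⟨_, _, rfl⟩)
        have hd' := hd.add (isDual_lead b ν hq hν p)
        rw [end_sub_add_cancel] at hd'
        have hR' : S + (-1 / (q - q⁻¹)) • dualLead b ν hq p ∈ diffAlg b ν :=
          Algebra.subset_adjoin (Or.inl ⟨_, _, hd'⟩)
        constructor
        · exact end_mem_of_add_mem (hle hT) (by rwa [end_sub_add_cancel])
        · have h := (diffAlg b ν).smul_mem (end_mem_of_add_mem (hle hS) hR') (-1 / (q - q⁻¹))⁻¹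
          rwa [inv_smul_smul₀ (div_ne_zero (by simp) hc)] at h
    refine Algebra.adjoin_le ?_
    rintro _ (⟨r, -, rfl⟩ | ⟨r, -, rfl⟩)
    exacts [(key r).1, (key r).2]

end Pairing
end QuantumMatrix

namespace QuantumMatrix

variable {n : ℕ} {q : ℂ}

/-! ### Comparison with the explicit operators -/

section Compare

variable (b : Module.Basis (Expo n) ℂ (Alg n q))

theorem opH_eq (m : ℤ) (i j : Fin n) : opH b m i j = torus b q (m • Pi.single (i, j) 1) := by
  refine b.ext fun a => ?_
  rw [torus_basis, weight_smul, weight_single]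
  simp [opH]

theorem list_filter_sum {A : Type*} [AddCommMonoid A] (P : Fin n → Prop) [DecidablePred P]
    (f : Fin n → A) :
    (((List.finRange n).filter P).map f).sum = ∑ k, if P k then f k else 0 := by
  rw [← List.sum_ofFn, List.ofFn_eq_map]
  induction List.finRange n with
  | nil => rfl
  | cons k l ih => by_cases h : P k <;> simp [h, ih]

theorem opVSE_eq (hq : q ≠ 0) (i j : Fin n) :
    opVSE b i j = (weylModel b hq).K (QWeyl.hookWeight (i, j)) := by
  have hprod : ∀ (l : List (Fin n)) (f : Fin n → Fin n × Fin n),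
      (l.map fun k => opH b 1 (f k).1 (f k).2).prod =
        (weylModel b hq).K ((l.map fun k => (Pi.single (f k) 1 : Fin n × Fin n → ℤ)).sum) := by
    intro l f
    induction l with
    | nil => exact (weylModel b hq).K_zero.symm
    | cons k l ih =>
      rw [List.map_cons, List.prod_cons, ih, List.map_cons, List.sum_cons,
        (weylModel b hq).K_add, opH_eq, one_smul]
      rfl
  rw [opVSE, hprod _ fun k => (k, j), hprod _ fun s => (i, s), ← QWeyl.K_add, list_filter_sum,
    list_filter_sum]
  congr 1
  ext ⟨k, l⟩
  simp only [Pi.add_apply, Finset.sum_apply, QWeyl.hookWeight_apply, QWeyl.hook,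
    Finset.mem_filter, Finset.mem_univ, true_and]
  have e1 : ∑ x, (if i < x then (Pi.single (x, j) 1 : Fin n × Fin n → ℤ) else 0) (k, l) =
      if l = j ∧ i < k then 1 else 0 := by
    rw [Finset.sum_eq_single k]
    · by_cases h : i < k <;> simp [h, Pi.single_apply]
    · intro x _ hx
      by_cases h : i < x <;> simp [h, hx.symm]
    · simp
  have e2 : ∑ x, (if j < x then (Pi.single (i, x) 1 : Fin n × Fin n → ℤ) else 0) (k, l) =
      if k = i ∧ j < l then 1 else 0 := by
    rw [Finset.sum_eq_single l]
    · by_cases h : j < l <;> simp [h, Pi.single_apply]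
    · intro x _ hx
      by_cases h : j < x <;> simp [h, hx.symm]
    · simp
  rw [e1, e2]
  split_ifs <;> omega

theorem qnumK_eq (hq : q ≠ 0) (a : ℕ) : qnumK q (a + 1) = q ^ (-(a : ℤ)) * qnumL q (a + 1) := by
  rw [qnumK, qnumL, Finset.mul_sum, ← Finset.sum_range_reflect]
  refine Finset.sum_congr rfl fun k hk => ?_
  have hk' : k ≤ a := Nat.lt_succ_iff.1 (Finset.mem_range.1 hk)
  rw [← zpow_add₀ hq]
  congr 1
  push_cast [Nat.add_sub_cancel, Nat.cast_sub hk']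
  ring

theorem qnumL_succ_ne_zero (hq0 : q ≠ 0) (hq : ∀ k : ℕ, 0 < k → q ^ k ≠ 1) (a : ℕ) :
    qnumL q (a + 1) ≠ 0 := by
  intro h
  have h1 := qnumL_mul hq0 (a + 1)
  rw [h, mul_zero, eq_comm, sub_eq_zero, zpow_neg, ← mul_eq_one_iff_eq_inv₀ (zpow_ne_zero _ hq0),
    zpow_natCast, ← pow_add] at h1
  exact hq _ (by omega) h1

theorem qnumK_succ_ne_zero (hq0 : q ≠ 0) (hq : ∀ k : ℕ, 0 < k → q ^ k ≠ 1) (a : ℕ) :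
    qnumK q (a + 1) ≠ 0 := by
  rw [qnumK_eq hq0]
  exact mul_ne_zero (zpow_ne_zero _ hq0) (qnumL_succ_ne_zero hq0 hq a)

theorem lower_qnumK (hq : q ≠ 0) (p : Fin n × Fin n) :
    lower b (qnumK q) p = torus b q (-Pi.single p 1) * lower b (qnumL q) p := by
  refine b.ext fun a => ?_
  by_cases h : a p.1 p.2 = 0
  · simp [h, qnumK_zero, qnumL_zero]
  · obtain ⟨c, rfl⟩ := exists_eq_add_unitExpo h
    simp only [Module.End.mul_apply, lower_basis, map_smul, torus_basis, add_unitExpo_sub,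
      Pi.add_apply, unitExpo_self, qnumK_eq hq, weight_neg, weight_single, smul_smul]
    rw [mul_comm]

theorem dualLead_qnumK (hq : q ≠ 0) (p : Fin n × Fin n) :
    dualLead b (qnumK q) hq p = (weylModel b hq).leadLower p := by
  rw [dualLead, lower_qnumK b hq]
  rfl

theorem opVSE_mul_opM (hq : q ≠ 0) (i j : Fin n) :
    opVSE b i j * opM b i j = (weylModel b hq).lead (i, j) := by
  rw [opVSE_eq b hq]
  exact QWeyl.K_hookWeight_mul_M _

theorem opVSE_mul_opCalD (hq : q ≠ 0) (i j : Fin n) :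
    opVSE b i j * opCalD b i j = dualLead b (qnumK q) hq (i, j) := by
  rw [opVSE_eq b hq]
  rfl

variable {b}

theorem lowerTermsGenerated_qnumL (hq : q ≠ 0) (hc : q - q⁻¹ ≠ 0) :
    LowerTermsGenerated b (qnumL q) hq :=
  fun S p h => QWeyl.lowerHook_mem_of_lead_mem (w := weylModel b hq) hc S p h

theorem lowerTermsGenerated_qnumK (hq : q ≠ 0) (hc : q - q⁻¹ ≠ 0) :
    LowerTermsGenerated b (qnumK q) hq := fun S p h =>
  QWeyl.lowerHook_mem_of_leadLower_mem (w := weylModel b hq) hq hc S p fun r hr =>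
    ⟨(h r hr).1, dualLead_qnumK b hq r ▸ (h r hr).2⟩

theorem leadAlg_qnumL (hq : q ≠ 0) (hc : q - q⁻¹ ≠ 0) :
    leadAlg b (qnumL q) hq Set.univ = weyl b := by
  apply le_antisymm
  · have hM : ∀ p, (weylModel b hq).M p ∈ weyl b := fun p =>
      Algebra.subset_adjoin (Or.inl ⟨p.1, p.2, rfl⟩)
    have hD : ∀ p, (weylModel b hq).D p ∈ weyl b := fun p =>
      Algebra.subset_adjoin (Or.inr ⟨p.1, p.2, rfl⟩)
    have h := QWeyl.lead_mem_of_weyl_mem (w := weylModel b hq) hc (weyl b) hM hD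
    refine Algebra.adjoin_le ?_
    rintro _ (⟨p, -, rfl⟩ | ⟨p, -, rfl⟩)
    · exact (h p).1
    · exact (h p).2
  · have h : ∀ p, (weylModel b hq).M p ∈ leadAlg b (qnumL q) hq Set.univ ∧
        (weylModel b hq).D p ∈ leadAlg b (qnumL q) hq Set.univ := fun p =>
      have h := QWeyl.weyl_mem_of_lead_mem (w := weylModel b hq) hc
        (leadAlg b (qnumL q) hq Set.univ) p fun r _ =>
          ⟨lead_mem_leadAlg hq (Set.mem_univ r), dualLead_mem_leadAlg hq (Set.mem_univ r)⟩
      ⟨h.1, h.2.1⟩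
    refine Algebra.adjoin_le ?_
    rintro _ (⟨i, j, rfl⟩ | ⟨i, j, rfl⟩)
    · exact (h (i, j)).1
    · exact (h (i, j)).2

theorem leadAlg_qnumK (hq : q ≠ 0) :
    leadAlg b (qnumK q) hq Set.univ = Algebra.adjoin ℂ
      ({T | ∃ i j : Fin n, T = opVSE b i j * opCalD b i j} ∪
        {T | ∃ i j : Fin n, T = opVSE b i j * opM b i j}) := by
  rw [leadAlg, Set.union_comm]
  congr 2
  · ext T
    simp [opVSE_mul_opCalD b hq, eq_comm]
  · ext T
    simp [opVSE_mul_opM b hq, eq_comm]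

end Compare

/-! ### The missing square of `H_11` -/

section Missing

namespace QWeyl

variable {N B : Type*} [DecidableEq N] [Ring B] [Algebra ℂ B] (w : QWeyl N q B)

/-- The elements `T` with `T M_o = q^{-2k} M_o T` for some natural number `k`, where `o` is a
fixed node. -/
def negEigen (o : N) : Set B :=
  {T | ∃ k : ℕ, T * w.M o = q ^ (-(2 * (k : ℤ))) • (w.M o * T)}

/-- The span of the elements that `q^{-2k}`-commute with `M_o` for some natural number `k`. -/
def negPart (o : N) : Submodule ℂ B := Submodule.span ℂ (w.negEigen o)

variable {w} {o : N}

theorem mem_negPart_of_commute {T : B} (h : T * w.M o = w.M o * T) : T ∈ w.negPart o :=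
  Submodule.subset_span ⟨0, by simpa using h⟩

theorem mul_mem_negPart (hq : q ≠ 0) {T S : B} (hT : T ∈ w.negPart o) (hS : S ∈ w.negPart o) :
    T * S ∈ w.negPart o := by
  have h : w.negPart o * w.negPart o ≤ w.negPart o := by
    rw [negPart, Submodule.span_mul_span]
    refine Submodule.span_mono ?_
    rintro _ ⟨T, ⟨k, hT⟩, S, ⟨l, hS⟩, rfl⟩
    refine ⟨k + l, ?_⟩
    rw [mul_assoc, hS, mul_smul_comm, ← mul_assoc, hT, smul_mul_assoc, smul_smul,
      ← zpow_add₀ hq, mul_assoc]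
    congr 2
    push_cast
    ring
  exact h (Submodule.mul_mem_mul hT hS)

theorem pow_mul_mem_negPart (hq : q ≠ 0) {T : B} (hT : T ∈ w.negPart o) (s : ℕ) :
    w.M o ^ s * T ∈ w.negPart o := by
  refine mul_mem_negPart hq (mem_negPart_of_commute ?_) hT
  rw [← pow_succ, ← pow_succ']

theorem mul_pow_of_negEigen {T : B} {k : ℕ}
    (h : T * w.M o = q ^ (-(2 * (k : ℤ))) • (w.M o * T)) (s : ℕ) :
    T * w.M o ^ s = (q ^ (-(2 * (k : ℤ)))) ^ s • (w.M o ^ s * T) := by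
  induction s with
  | zero => simp
  | succ s ih =>
    rw [pow_succ, ← mul_assoc, ih, smul_mul_assoc, mul_assoc, h, mul_smul_comm, smul_smul,
      ← mul_assoc, pow_succ]

theorem exists_pow_mul_eq_mul_pow (hq : q ≠ 0) (s : ℕ) {T : B} (hT : T ∈ w.negPart o) :
    ∃ T' ∈ w.negPart o, w.M o ^ s * T = T' * w.M o ^ s := by
  induction hT using Submodule.span_induction with
  | mem T hT =>
    obtain ⟨k, hk⟩ := hT
    have h0 : (q ^ (-(2 * (k : ℤ)))) ^ s ≠ 0 := pow_ne_zero _ (zpow_ne_zero _ hq)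
    refine ⟨((q ^ (-(2 * (k : ℤ)))) ^ s)⁻¹ • T,
      Submodule.smul_mem _ _ (Submodule.subset_span ⟨k, hk⟩), ?_⟩
    rw [smul_mul_assoc, mul_pow_of_negEigen hk, inv_smul_smul₀ h0]
  | zero => exact ⟨0, Submodule.zero_mem _, by simp⟩
  | add T S _ _ hT hS =>
    obtain ⟨T', hT', h⟩ := hT
    obtain ⟨S', hS', h'⟩ := hS
    exact ⟨T' + S', Submodule.add_mem _ hT' hS', by rw [mul_add, h, h', add_mul]⟩
  | smul r T _ hT =>
    obtain ⟨T', hT', h⟩ := hT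
    exact ⟨r • T', Submodule.smul_mem _ _ hT', by rw [mul_smul_comm, h, smul_mul_assoc]⟩

variable (w o)

/-- The elements `T` such that `M_o^s T` lies in `negPart` for some `s`: as functions of the
exponent `a_o`, their matrix coefficients are polynomials in `q^{-2 a_o}`. -/
def polynomialPart (hq : q ≠ 0) : Subalgebra ℂ B where
  carrier := {T | ∃ s : ℕ, w.M o ^ s * T ∈ w.negPart o}
  mul_mem' := by
    rintro T S ⟨s, hT⟩ ⟨r, hS⟩
    obtain ⟨T', hT', h⟩ := exists_pow_mul_eq_mul_pow hq r hT
    refine ⟨r + s, ?_⟩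
    have e : w.M o ^ (r + s) * (T * S) = T' * (w.M o ^ r * S) := by
      rw [pow_add, mul_assoc, ← mul_assoc _ T, ← mul_assoc, h, mul_assoc]
    rw [e]
    exact mul_mem_negPart hq hT' hS
  add_mem' := by
    rintro T S ⟨s, hT⟩ ⟨r, hS⟩
    refine ⟨r + s, ?_⟩
    rw [mul_add]
    refine Submodule.add_mem _ ?_ ?_
    · rw [pow_add, mul_assoc]
      exact pow_mul_mem_negPart hq hT r
    · rw [add_comm, pow_add, mul_assoc]
      exact pow_mul_mem_negPart hq hS s
  algebraMap_mem' r := ⟨0, mem_negPart_of_commute (by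
    rw [pow_zero, one_mul, Algebra.commutes])⟩

end QWeyl

variable {B : Type*} [Ring B] [Algebra ℂ B] {w : QWeyl (Fin n × Fin n) q B}

theorem zero_notMem_hook [NeZero n] (p : Fin n × Fin n) : (0 : Fin n × Fin n) ∉ QWeyl.hook p := by
  simp [QWeyl.hook]

theorem lead_mem_polynomialPart [NeZero n] (hq : q ≠ 0) (p : Fin n × Fin n) :
    w.lead p ∈ w.polynomialPart 0 hq := by
  refine ⟨0, QWeyl.mem_negPart_of_commute ?_⟩
  rw [pow_zero, one_mul, QWeyl.lead, mul_assoc, w.K_M, QWeyl.hookWeight_apply,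
    if_neg (zero_notMem_hook p), zpow_zero, one_smul, ← mul_assoc, w.M_comm, mul_assoc]

theorem leadLower_mem_polynomialPart [NeZero n] (hq : q ≠ 0) (hc : q - q⁻¹ ≠ 0) (p : Fin n × Fin n) :
    w.leadLower p ∈ w.polynomialPart 0 hq := by
  rcases eq_or_ne p 0 with rfl | hp
  · refine ⟨1, ?_⟩
    -- `M V 𝒟` is a combination of `V` and `V H⁻²`
    have h : (q - q⁻¹) • (w.M 0 ^ 1 * w.leadLower 0) =
        q • (w.K (QWeyl.hookWeight 0) -
          w.K (QWeyl.hookWeight 0 - (2 : ℤ) • Pi.single 0 1)) := by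
      rw [pow_one, QWeyl.leadLower_eq, mul_smul_comm, smul_comm, ← mul_assoc, ← smul_mul_assoc,
        w.MD, sub_mul, ← w.K_add, ← w.K_add]
      congr 3 <;> abel_nf
    have h0 : w.K (QWeyl.hookWeight 0) ∈ w.negPart 0 := by
      refine QWeyl.mem_negPart_of_commute ?_
      rw [w.K_M, QWeyl.hookWeight_self, zpow_zero, one_smul]
    have h1 : w.K (QWeyl.hookWeight 0 - (2 : ℤ) • Pi.single 0 1) ∈ w.negPart 0 := by
      refine Submodule.subset_span ⟨1, ?_⟩
      rw [w.K_M, Pi.sub_apply, QWeyl.hookWeight_self]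
      simp
    have h2 := Submodule.smul_mem _ (q - q⁻¹)⁻¹
      (h ▸ Submodule.smul_mem _ q (Submodule.sub_mem _ h0 h1))
    rwa [inv_smul_smul₀ hc] at h2
  · refine ⟨0, QWeyl.mem_negPart_of_commute ?_⟩
    rw [pow_zero, one_mul, QWeyl.leadLower_eq, smul_mul_assoc, mul_smul_comm, mul_assoc, w.K_M,
      Pi.sub_apply, QWeyl.hookWeight_apply, if_neg (zero_notMem_hook p), Pi.single_apply,
      if_neg hp.symm, sub_zero, zpow_zero, one_smul, ← mul_assoc, ← w.MD_comm _ _ hp.symm,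
      mul_assoc]

section Model

variable {E : Type*} [AddCommGroup E] [Module ℂ E] (b : Module.Basis (Expo n) ℂ E)

theorem raise_pow_basis (p : Fin n × Fin n) (m : ℕ) (a : Expo n) :
    (raise b p ^ m) (b a) = b (a + m • unitExpo p.1 p.2) := by
  induction m with
  | zero => simp
  | succ m ih => rw [pow_succ', Module.End.mul_apply, ih, raise_basis, add_assoc, succ_nsmul]

theorem coord_raise_pow (p : Fin n × Fin n) (m : ℕ) (c : Expo n) (u : E) :
    b.coord (c + m • unitExpo p.1 p.2) ((raise b p ^ m) u) = b.coord c u := by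
  have e : b.coord (c + m • unitExpo p.1 p.2) ∘ₗ (raise b p ^ m) = b.coord c := b.ext fun a => by
    simp [raise_pow_basis, Finsupp.single_apply]
  exact LinearMap.congr_fun e u

/-- The matrix coefficients of an element of `negPart` along the powers of `M_o` are given by a
polynomial in `q^{-2m}`. -/
theorem exists_polynomial_coord (hq : q ≠ 0) (o : Fin n × Fin n) (c : Expo n)
    {T : Module.End ℂ E} (hT : T ∈ (weylModel b hq).negPart o) :
    ∃ P : Polynomial ℂ, ∀ m : ℕ, b.coord (c + m • unitExpo o.1 o.2)
      (T (b (m • unitExpo o.1 o.2))) = P.eval ((q ^ (-2 : ℤ)) ^ m) := by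
  induction hT using Submodule.span_induction with
  | mem T hT =>
    obtain ⟨k, hk⟩ := hT
    refine ⟨Polynomial.monomial k (b.coord c (T (b 0))), fun m => ?_⟩
    have h1 : b (m • unitExpo o.1 o.2) = (raise b o ^ m) (b 0) := by
      rw [raise_pow_basis, zero_add]
    have h2 := LinearMap.congr_fun (QWeyl.mul_pow_of_negEigen hk m) (b 0)
    rw [Module.End.mul_apply, LinearMap.smul_apply, Module.End.mul_apply] at h2
    have h3 : (q ^ (-(2 * (k : ℤ)))) ^ m = ((q ^ (-2 : ℤ)) ^ m) ^ k := by
      rw [← pow_mul, ← zpow_natCast, ← zpow_natCast, ← zpow_mul, ← zpow_mul]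
      congr 1
      push_cast
      ring
    rw [h1]
    change b.coord _ (T (((weylModel b hq).M o ^ m) (b 0))) = _
    rw [h2, map_smul, h3, Polynomial.eval_monomial, smul_eq_mul, mul_comm]
    congr 1
    exact coord_raise_pow b o m c _
  | zero => exact ⟨0, by simp⟩
  | add T S _ _ hT hS =>
    obtain ⟨P, hP⟩ := hT
    obtain ⟨Q, hQ⟩ := hS
    exact ⟨P + Q, fun m => by rw [LinearMap.add_apply, map_add, hP, hQ, Polynomial.eval_add]⟩
  | smul r T _ hT =>
    obtain ⟨P, hP⟩ := hT
    exact ⟨Polynomial.C r * P, fun m => by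
      rw [LinearMap.smul_apply, map_smul, hP]; simp⟩

/-- `q^{2m}` is not a polynomial in `q^{-2m}`. -/
theorem K_two_notMem_polynomialPart (hq0 : q ≠ 0) (hq : ∀ k : ℕ, 0 < k → q ^ k ≠ 1)
    (o : Fin n × Fin n) :
    (weylModel b hq0).K ((2 : ℤ) • Pi.single o 1) ∉ (weylModel b hq0).polynomialPart o hq0 := by
  rintro ⟨s, hs⟩
  obtain ⟨P, hP⟩ := exists_polynomial_coord b hq0 o (s • unitExpo o.1 o.2) hs
  have hval : ∀ m : ℕ, P.eval ((q ^ (-2 : ℤ)) ^ m) = q ^ (2 * (m : ℤ)) := by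
    intro m
    rw [← hP m]
    have h1 : (weylModel b hq0).K ((2 : ℤ) • Pi.single o 1) (b (m • unitExpo o.1 o.2)) =
        q ^ (2 * (m : ℤ)) • b (m • unitExpo o.1 o.2) := by
      change torus b q _ _ = _
      rw [torus_basis, weight_smul, weight_single]
      simp
    have h2 := raise_pow_basis b o s (m • unitExpo o.1 o.2)
    rw [Module.End.mul_apply, h1, map_smul, map_smul]
    change _ • b.coord _ ((raise b o ^ s) _) = _
    rw [h2, add_comm]
    simp
  have hinj : Function.Injective fun m : ℕ => (q ^ (-2 : ℤ)) ^ m := by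
    have hlt : ∀ m k : ℕ, m < k → (q ^ (-2 : ℤ)) ^ m ≠ (q ^ (-2 : ℤ)) ^ k := by
      intro m k hmk h
      rw [zpow_neg, inv_pow, inv_pow, inv_inj, ← zpow_natCast, ← zpow_natCast, ← zpow_mul,
        ← zpow_mul] at h
      have h1 : q ^ (2 * (k : ℤ) - 2 * (m : ℤ)) = 1 := by
        rw [zpow_sub₀ hq0, ← h, div_self (zpow_ne_zero _ hq0)]
      have h2 : (2 * (k : ℤ) - 2 * (m : ℤ)) = ((2 * (k - m) : ℕ) : ℤ) := by
        push_cast [Nat.cast_sub hmk.le]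
        ring
      rw [h2, zpow_natCast] at h1
      exact hq _ (by omega) h1
    intro m k h
    rcases lt_trichotomy m k with hmk | hmk | hmk
    · exact absurd h (hlt m k hmk)
    · exact hmk
    · exact absurd h.symm (hlt k m hmk)
  have hzero : P * Polynomial.X - 1 = 0 := by
    refine Polynomial.eq_zero_of_infinite_isRoot _ ((Set.infinite_range_of_injective hinj).mono ?_)
    rintro _ ⟨m, rfl⟩
    change Polynomial.IsRoot _ _
    rw [Polynomial.IsRoot.def, Polynomial.eval_sub, Polynomial.eval_mul, Polynomial.eval_X,
      Polynomial.eval_one, hval]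
    change _ * (q ^ (-2 : ℤ)) ^ m - 1 = 0
    rw [← zpow_natCast, ← zpow_mul, ← zpow_add₀ hq0]
    ring_nf
    simp
  have := congrArg (Polynomial.eval 0) hzero
  simp at this

end Model

end Missing

end QuantumMatrix

theorem proposition8 (n : ℕ) [NeZero n] (q : ℂ) (hq0 : q ≠ 0)
    (hq : ∀ k : ℕ, 0 < k → q ^ k ≠ 1) :
    -- the ordered monomials form a basis of the quadratic algebra
    ∃ b : Module.Basis (QuantumMatrix.Expo n) ℂ (QuantumMatrix.Alg n q),
      (∀ a, b a = QuantumMatrix.mono q a) ∧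
      -- the duals of the right multiplications exist and are unique, for both forms
      (∀ i j : Fin n, ∃! S, QuantumMatrix.IsDual
        (QuantumMatrix.pairing b (QuantumMatrix.qnumL q)) (QuantumMatrix.rightMul q i j) S) ∧
      (∀ i j : Fin n, ∃! S, QuantumMatrix.IsDual
        (QuantumMatrix.pairing b (QuantumMatrix.qnumK q)) (QuantumMatrix.rightMul q i j) S) ∧
      -- case `L`
      QuantumMatrix.diffAlg b (QuantumMatrix.qnumL q) = QuantumMatrix.weyl b ∧
      -- case `K`
      QuantumMatrix.diffAlg b (QuantumMatrix.qnumK q) =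
        Algebra.adjoin ℂ
          ({T | ∃ i j : Fin n, T = QuantumMatrix.opVSE b i j * QuantumMatrix.opCalD b i j} ∪
            {T | ∃ i j : Fin n, T = QuantumMatrix.opVSE b i j * QuantumMatrix.opM b i j}) ∧
      (∀ i j : Fin n, (i, j) ≠ (0, 0) →
        QuantumMatrix.opH b 2 i j ∈ QuantumMatrix.diffAlg b (QuantumMatrix.qnumK q) ∧
        QuantumMatrix.opH b (-2) i j ∈ QuantumMatrix.diffAlg b (QuantumMatrix.qnumK q)) ∧
      QuantumMatrix.opH b (-2) 0 0 ∈ QuantumMatrix.diffAlg b (QuantumMatrix.qnumK q) ∧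
      QuantumMatrix.opH b 2 0 0 ∉ QuantumMatrix.diffAlg b (QuantumMatrix.qnumK q) := by
  open QuantumMatrix in
  have hc : q - q⁻¹ ≠ 0 := by
    intro h
    rw [sub_eq_zero, ← mul_eq_one_iff_eq_inv₀ hq0, ← sq] at h
    exact hq 2 two_pos h
  obtain ⟨b, hb, hR⟩ := exists_basis_mono (n := n) hq0
  have hL := qnumL_succ_ne_zero hq0 hq
  have hK := qnumK_succ_ne_zero hq0 hq
  have hQL := lowerTermsGenerated_qnumL (b := b) hq0 hc
  have hQK := lowerTermsGenerated_qnumK (b := b) hq0 hc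
  have hdK : diffAlg b (qnumK q) = leadAlg b (qnumK q) hq0 Set.univ :=
    diffAlg_eq_leadAlg hq0 hc qnumK_zero hK hR hQK
  have hmem : ∀ r, (weylModel b hq0).lead r ∈ diffAlg b (qnumK q) ∧
      (weylModel b hq0).leadLower r ∈ diffAlg b (qnumK q) := fun r => by
    rw [hdK, ← dualLead_qnumK b hq0]
    exact ⟨lead_mem_leadAlg hq0 (Set.mem_univ r), dualLead_mem_leadAlg hq0 (Set.mem_univ r)⟩
  have hneg : ∀ i j : Fin n, opH b (-2) i j ∈ diffAlg b (qnumK q) := fun i j => by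
    rw [opH_eq]
    exact QWeyl.K_neg_two_mem (w := weylModel b hq0) hc _ (i, j) fun r _ => hmem r
  refine ⟨b, hb, existsUnique_isDual_rightMul hq0 hc qnumL_zero hL hR hQL,
    existsUnique_isDual_rightMul hq0 hc qnumK_zero hK hR hQK,
    (diffAlg_eq_leadAlg hq0 hc qnumL_zero hL hR hQL).trans (leadAlg_qnumL hq0 hc),
    hdK.trans (leadAlg_qnumK hq0), fun i j hij => ⟨?_, hneg i j⟩, hneg 0 0, ?_⟩
  · rw [opH_eq]
    rcases eq_or_ne j 0 with rfl | hj
    · have hi : i ≠ 0 := fun h => hij (by rw [h])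
      have hr : (i, (0 : Fin n)) ∈ QWeyl.hook ((0 : Fin n), (0 : Fin n)) := by
        simp [QWeyl.hook, Fin.pos_iff_ne_zero, hi]
      exact QWeyl.K_two_mem (w := weylModel b hq0) hq0 hc _ hmem hr
    · have hr : (i, j) ∈ QWeyl.hook (i, (0 : Fin n)) := by
        simp [QWeyl.hook, Fin.pos_iff_ne_zero, hj]
      exact QWeyl.K_two_mem (w := weylModel b hq0) hq0 hc _ hmem hr
  · intro h
    refine K_two_notMem_polynomialPart b hq0 hq 0 ?_
    have hle : diffAlg b (qnumK q) ≤ (weylModel b hq0).polynomialPart 0 hq0 := by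
      rw [hdK]
      refine Algebra.adjoin_le ?_
      rintro _ (⟨r, -, rfl⟩ | ⟨r, -, rfl⟩)
      · exact lead_mem_polynomialPart hq0 r
      · rw [dualLead_qnumK]
        exact leadLower_mem_polynomialPart hq0 hc r
    rw [opH_eq] at h
    exact hle h
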